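/- Let $U$ be a finite, linearly ordered (labelled) ground set and let $\mathcal F\subseteq 2^U$ with $\emptyset\in\mathcal F$; the members of $\mathcal F$ are called solutions. $(U,\mathcal F)$ is \emph{strongly accessible} if for all $X\subsetneq Y$ in $\mathcal F$ there is $z\in Y\setminus X$ with $X\cup\{z\}\in\mathcal F$. It is \emph{commutable} if moreover, for all $X\subsetneq Y$ in $\mathcal F$ with $X\ne\emptyset$ and all $a,b\in Y\setminus X$, $X\cup\{a\}\in\mathcal F$ and $X\cup\{b\}\in\mathcal F$ imply $X\cup\{a,b\}\in\mathcal F$. Let $q$ be the largest size of a solution, $X^+_A=\{a\in A\setminus X: X\cup\{a\}\in\mathcal F\}$, $X^+=X^+_U$ and $Z=\{x\in U:\{x\}\in\mathcal F\}$. \textbf{Black boxes.} Membership $X\in\mathcal F$ can be tested in at most $G_T\ge 1$ steps. For every maximal solution $P$ and $w\in U\setminus P$, the restricted problem, to list without repetition the maximal solutions $R\neq P$ of the reduced system $(P\cup\{w\},\mathcal F)$ (listing $P$ as well is allowed), is solved in at most $R_T$ steps, and at most $R_B$ sets are listed, where $R_B\ge 1$. \textbf{Routines.} $\mathrm{source}(X)=\min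 (X\cap Z)$. For $X\in\mathcal F$, $X\neq\emptyset$, with $t=\mathrm{source}(X)$, put $B_0=\{t\}$, $B_i=B_{i-1}\cup(B_{i-1}^+\cap X)$, and $\mathrm{lay}^X(y)=\min\{i\ge1: y\in B_{i-1}^+\}$. $\mathrm{choose}(X,A)$ returns the $y\in X^+_A$ with lexicographically least pair $\langle \mathrm{lay}^X(y),y\rangle$. $\mathrm{complete}(X,A)$ repeats $X\leftarrow X\cup\{\mathrm{choose}(X,A)\}$ while $X^+_A\ne\emptyset$ and returns $X$; $\mathrm{complete}(X,A)|_w$ is the same, but stops, without adding $w$, as soon as $w$ is chosen. The canonical order $s_1,s_2,\dots$ of a maximal solution $S$ is the order in which $\mathrm{complete}(\{\mathrm{source}(S)\},S)$ collects its elements, starting with $s_1=\mathrm{source}(S)$; $S[j]=\{s_1,\dots,s_j\}$. Let $j$ be least with $\mathrm{complete}(S[j],U)=S$. If $j>1$, then $\mathrm{pi}(S)=s_j$, $\mathrm{core}(S)=S[j-1]$, $\mathrm{parent}(S)=\mathrm{complete}(\mathrm{core}(S),U)$ and $\mathrm{r}(S)=\mathrm{complete}(\mathrm{core}(S)\cup\{\mathrm{pi}(S)\},\mathrm{parent}(S)\cup\{\mathrm{pi}(S)\})$;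 otherwise $S$ is a root (if $\mathcal F=\{\emptyset\}$, then $\emptyset$ is a root). The roots are found by testing, for each $s\in Z$, whether $S=\mathrm{complete}(\{s\},U)$ has source $s$. The pair $\mathrm{core}(S),\mathrm{pi}(S)$ is computed in a single run along the canonical order, as the last prefix $S[i]$ with $\mathrm{choose}(S[i],U)\ne s_{i+1}$ together with $s_{i+1}$. \textbf{Algorithm.} Call $\mathrm{spawn}(S)$ for each root $S$, at depth $0$. $\mathrm{spawn}(X)$ at depth $d$ outputs $X$ at the beginning if $d$ is odd and at the end if $d$ is even; in between, for each $w\in U$ and each $S$ yielded by $\mathrm{children}(X,w)$, it calls $\mathrm{spawn}(S)$ at depth $d+1$. $\mathrm{children}(P,w)$ yields nothing if $w\in P$; otherwise, for each solution $R\ne P$ of the restricted problem for $(P,w)$ and each $s\in (R\cap Z)\setminus\{w\}$, it computes $S=\mathrm{complete}\bigl(\mathrm{complete}(\{s\},R)|_w\cup\{w\},\,U\bigr)$ and yields $S$ if $\langle\mathrm{parent}(S),\mathrm{pi}(S),\mathrm{r}(S),\mathrm{source}(S)\rangle=\langle P,w,R,s\rangle$. \textbf{Cost.} Besides the black box calls,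 each loop iteration, comparison of labels, and access to or change of one entry of a bit array (representing a subset of $U$) costs one step; creating, copying, comparing, counting or writing out a whole such array costs $|U|$ steps. The delay is the largest number of steps before the first output, between two consecutive outputs, or between the last output and termination. \textbf{Theorem.} For every commutable set system, with any such black boxes, the implemented routines compute $\mathrm{choose}$, $\mathrm{core}$ and $\mathrm{pi}$ as defined above, and the algorithm terminates and outputs every maximal solution of $(U,\mathcal F)$ exactly once and nothing else. If $q\ge1$, its delay is $$O\bigl(R_T\cdot|U|+q^3\,|U|^2\cdot G_T\cdot R_B\bigr)$$ with an absolute constant. In particular this applies to connected hereditary set systems, which are commutable: those for which there is a graph $G$ with vertex set $U$ such that $\emptyset\in\mathcal F$, every nonempty solution induces a connected subgraph of $G$, and every nonempty $X\subseteq Y\in\mathcal F$ inducing a connected subgraph of $G$ is a solution. -/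

import Mathlib

universe u

namespace MaxEnum

section SetSystems

variable {U : Type u} [Fintype U] [LinearOrder U]

/-- `X⁺_A`: the elements of `A` outside `X` that can be added to `X` inside the family `F`. -/
def plus (F : Finset (Finset U)) (X A : Finset U) : Finset U :=
  A.filter fun a => a ∉ X ∧ insert a X ∈ F

/-- Strong accessibility, together with the standing convention that `∅` is a solution. -/
def IsStronglyAccessible (F : Finset (Finset U)) : Prop :=
  ∅ ∈ F ∧ ∀ X ∈ F, ∀ Y ∈ F, X ⊂ Y → ∃ z ∈ Y \ X, insert z X ∈ F

/-- Commutable set systems: strongly accessible, with the commutable property. -/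
def IsCommutable (F : Finset (Finset U)) : Prop :=
  IsStronglyAccessible F ∧
    ∀ X ∈ F, ∀ Y ∈ F, X.Nonempty → X ⊂ Y → ∀ a ∈ Y \ X, ∀ b ∈ Y \ X,
      insert a X ∈ F → insert b X ∈ F → insert a (insert b X) ∈ F

/-- `S` is a maximal solution of the reduced system `(A, F)`: among the solutions contained in
`A`, it is maximal under inclusion. -/
def IsMaximalIn (F : Finset (Finset U)) (A S : Finset U) : Prop :=
  S ∈ F ∧ S ⊆ A ∧ ∀ Y ∈ F, Y ⊆ A → S ⊆ Y → Y = S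

/-- `S` is a maximal solution of `(U, F)`. -/
def IsMaximalSol (F : Finset (Finset U)) (S : Finset U) : Prop :=
  IsMaximalIn F Finset.univ S

/-- `q`: the largest size of a solution. -/
def maxSize (F : Finset (Finset U)) : ℕ := F.sup Finset.card

/-- The family `F` of vertex sets is induced by a connected hereditary property of the graph `G`:
all nonempty solutions are connected in `G`, and connected subsets of solutions are solutions. -/
def IsConnectedHereditary (G : SimpleGraph U) (F : Finset (Finset U)) : Prop :=
  ∅ ∈ F ∧ (∀ X ∈ F, X.Nonempty → (G.induce (X : Set U)).Connected) ∧
    ∀ X : Finset U, ∀ Y ∈ F, X ⊆ Y → X.Nonempty → (G.induce (X : Set U)).Connected → X ∈ F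

/-- `t` is `SOURCE(X)`, the smallest `x ∈ X` with `{x} ∈ F`. -/
def IsSource (F : Finset (Finset U)) (X : Finset U) (t : U) : Prop :=
  (t ∈ X ∧ {t} ∈ F) ∧ ∀ x ∈ X, {x} ∈ F → t ≤ x

/-- The sets `B_i` of the layer decomposition of `X` from the starting element `t`. -/
def layerSet (F : Finset (Finset U)) (X : Finset U) (t : U) : ℕ → Finset U
  | 0 => {t}
  | i + 1 => layerSet F X t i ∪ plus F (layerSet F X t i) X

/-- `LAY_t^X(y) = min {i : y ∈ B_{i-1}⁺}` (and `0` if there is no such `i`, as for `y = t`). -/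
noncomputable def lay (F : Finset (Finset U)) (X : Finset U) (t y : U) : ℕ :=
  sInf {i | 0 < i ∧ y ∈ plus F (layerSet F X t (i - 1)) Finset.univ}

/-- `y = argmin_{y ∈ X⁺_A} ⟨LAY^X(y), y⟩`, the layers being taken from `t`. -/
def IsArgmin (F : Finset (Finset U)) (X A : Finset U) (t y : U) : Prop :=
  y ∈ plus F X A ∧ ∀ z ∈ plus F X A, toLex (lay F X t y, y) ≤ toLex (lay F X t z, z)

end SetSystems

section CostModel

/-! Cost model: a random access machine. Elements of `U` are machine words, a subset of `U` is a
bit array. Every loop iteration, comparison of words, access to or change of one entry of a bit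
array is charged one step; creating, copying, comparing or counting a whole bit array is charged
`|U|` steps. Routines without output are written in the monad `Timed`, which adds up the charged
steps; apart from the calls below, they only branch on and pass around computed values. -/

/-- The result of a routine with the number of steps it took. -/
structure Timed (α : Type u) where
  val : α
  time : ℕ

instance : Monad Timed.{u} where
  pure a := ⟨a, 0⟩
  bind x f := ⟨(f x.val).val, x.time + (f x.val).time⟩

/-- Spend `k` steps, then continue with `x`. -/
def Timed.after {α : Type u} (k : ℕ) (x : Timed α) : Timed α := ⟨x.val, k + x.time⟩

/-- `for a in l`, updating a state. -/
def forEach {α σ : Type u} (body : σ → α → Timed σ) : List α → σ → Timed σ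
  | [], s => .after 1 (pure s)
  | a :: l, s => .after 1 do
      let s' ← body s a
      forEach body l s'

/-- The first entry of a list that passes a test. -/
def findFirst {α : Type u} (p : α → Timed (ULift Bool)) : List α → Timed (Option α)
  | [] => .after 1 (pure none)
  | a :: l => .after 1 do
      let b ← p a
      if b.down then pure (some a) else findFirst p l

/-- Observable events of a run: internal work (a number of steps), and handing over a set, which
is a `yield` for a generator and an output for the whole algorithm. -/
inductive Event (U : Type u)
  | work (k : ℕ)
  | emit (S : Finset U)

/-- The chronological record of a run. Sequential composition is concatenation. -/
abbrev Log (U : Type u) := List (Event U)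

/-- Run a timed routine, then continue with its result. -/
def Timed.andThen {U α : Type u} (x : Timed α) (k : α → Log U) : Log U :=
  Event.work x.time :: k x.val

/-- `for a in l`, at one step per iteration. -/
def forLog {U α : Type u} (l : List α) (body : α → Log U) : Log U :=
  l.flatMap fun a => Event.work 1 :: body a

/-- The record of a loop `for S in generator do k(S)`: each `yield S` is replaced by the record of
`k S`; the result is `none` if one of these calls does not return. -/
def expand {U : Type u} (k : Finset U → Option (Log U)) : Log U → Option (Log U)
  | [] => some []
  | .work c :: l => (expand k l).map (Event.work c :: ·)
  | .emit S :: l => (k S).bind fun a => (expand k l).map (a ++ ·)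

/-- The sets output in a run, in chronological order. -/
def outputs {U : Type u} : Log U → List (Finset U)
  | [] => []
  | .work _ :: l => outputs l
  | .emit S :: l => S :: outputs l

/-- Auxiliary to `delay`; `acc` is the number of steps since the last output. -/
def delayFrom {U : Type u} (acc : ℕ) : Log U → ℕ
  | [] => acc
  | .work k :: l => delayFrom (acc + k) l
  | .emit _ :: l => max acc (delayFrom 0 l)

/-- The delay: the maximal number of steps before the first output, between two consecutive
outputs, and between the last output and termination. -/
def delay {U : Type u} (l : Log U) : ℕ := delayFrom 0 l

end CostModel

section Algorithm

/-- The two black boxes of the algorithm: a membership test for `F`, of which only the running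
time is left open, and a procedure for the restricted problems, which for a maximal solution `P`
and `w ∉ P` lists the maximal solutions `R ≠ P` of `(P ∪ {w}, F)` without repetition (it may or
may not list `P` as well), with its running time. -/
structure BlackBox {U : Type u} [Fintype U] [LinearOrder U] (F : Finset (Finset U)) where
  testTime : Finset U → ℕ
  restr : Finset U → U → List (Finset U)
  restrTime : Finset U → U → ℕ
  restr_nodup : ∀ P, IsMaximalSol F P → ∀ w ∉ P, (restr P w).Nodup
  mem_restr : ∀ P, IsMaximalSol F P → ∀ w ∉ P, ∀ R, R ≠ P →
    (R ∈ restr P w ↔ IsMaximalIn F (insert w P) R)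

variable {U : Type u} [Fintype U] [LinearOrder U] {F : Finset (Finset U)}

/-! Machine primitives. -/

/-- The elements of `U` by increasing label. -/
def elems (U : Type u) [Fintype U] [LinearOrder U] : List U :=
  (Finset.univ : Finset U).sort (· ≤ ·)

def contains (x : U) (X : Finset U) : Timed (ULift.{u} Bool) := ⟨⟨decide (x ∈ X)⟩, 1⟩

def sameElt (x y : U) : Timed (ULift.{u} Bool) := ⟨⟨decide (x = y)⟩, 1⟩

def insertElt (x : U) (X : Finset U) : Timed (Finset U) := ⟨insert x X, 1⟩

def emptySet : Timed (Finset U) := ⟨∅, Fintype.card U⟩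

def fullSet : Timed (Finset U) := ⟨Finset.univ, Fintype.card U⟩

def copySet (X : Finset U) : Timed (Finset U) := ⟨X, Fintype.card U⟩

def sameSet (X Y : Finset U) : Timed (ULift.{u} Bool) := ⟨⟨decide (X = Y)⟩, Fintype.card U⟩

def sizeOfSet (X : Finset U) : Timed (ULift.{u} ℕ) := ⟨⟨X.card⟩, Fintype.card U⟩

/-- Call of the membership test for `F`. -/
def test (O : BlackBox F) (X : Finset U) : Timed (ULift.{u} Bool) :=
  ⟨⟨decide (X ∈ F)⟩, O.testTime X⟩

/-- Call of the procedure for the restricted problem. -/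
def solveRestr (O : BlackBox F) (P : Finset U) (w : U) : Timed (List (Finset U)) :=
  ⟨O.restr P w, O.restrTime P w⟩

/-! Routines. -/

/-- Is `y ∈ X⁺`? The two extra steps insert `y` for the test and remove it afterwards. -/
def canAdd (O : BlackBox F) (X : Finset U) (y : U) : Timed (ULift.{u} Bool) := do
  let b ← contains y X
  if b.down then pure ⟨false⟩ else .after 2 (test O (insert y X))

/-- Is `{x} ∈ F`, that is, `x ∈ Z`? -/
def isGood (O : BlackBox F) (x : U) : Timed (ULift.{u} Bool) := do
  let E ← emptySet
  let X ← insertElt x E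
  test O X

/-- `SOURCE(X)`. -/
def source (O : BlackBox F) (X : Finset U) : Timed (Option U) :=
  findFirst (fun x => do
    let b ← contains x X
    if b.down then isGood O x else pure ⟨false⟩) (elems U)

/-- From `B = B_i` compute `B_{i+1} = B_i ∪ (B_i⁺ ∩ X)`. -/
def nextLayer (O : BlackBox F) (X B : Finset U) : Timed (Finset U) := do
  let C ← copySet B
  forEach (fun C y => do
    let b ← contains y X
    if b.down then
      let c ← canAdd O B y
      if c.down then insertElt y C else pure C
    else pure C) (elems U) C

/-- `n` further sets of the sequence `B_0, B_1, …`, starting from `B`. -/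
def layerSets (O : BlackBox F) (X : Finset U) : ℕ → Finset U → Timed (List (Finset U))
  | 0, B => .after 1 (pure [B])
  | n + 1, B => .after 1 do
      let B' ← nextLayer O X B
      let l ← layerSets O X n B'
      pure (B :: l)

/-- `1 +` the position of the first `B` in the list with `y ∈ B⁺` (`⊤` if there is none). -/
def layerOf (O : BlackBox F) (y : U) : List (Finset U) → Timed (ULift.{u} (WithTop ℕ))
  | [] => .after 1 (pure ⟨⊤⟩)
  | B :: l => .after 1 do
      let b ← canAdd O B y
      if b.down then pure ⟨1⟩
      else
        let r ← layerOf O y l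
        pure ⟨r.down + 1⟩

/-- `CHOOSE(X, A)`: compute the sets `B_i` for `X` from its source, then look for the element of
`X⁺_A` whose pair (layer, label) is least; `none` if `X⁺_A` is empty. -/
def choose (O : BlackBox F) (X A : Finset U) : Timed (Option U) := do
  let t ← source O X
  match t with
  | none => pure none
  | some t =>
    let n ← sizeOfSet X
    let E ← emptySet
    let B ← insertElt t E
    let Bs ← layerSets O X n.down B
    let best ← forEach (fun (best : Option (ULift.{u} (WithTop ℕ) × U)) y => do
      let a ← contains y A
      if a.down then
        let c ← canAdd O X y
        if c.down then
          let l ← layerOf O y Bs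
          .after 1 <| match best with
            | none => pure (some (l, y))
            | some (l', y') =>
              if l.down < l'.down ∨ (l.down = l'.down ∧ y < y') then pure (some (l, y))
              else pure best
        else pure best
      else pure best) (elems U) none
    pure (best.map Prod.snd)

/-- The while loop of `COMPLETE`; it stops as well when `halt` is chosen. Every iteration adds an
element of `U`, so that `|U| + 1` is no restriction on the number of iterations. -/
def completeLoop (O : BlackBox F) (A : Finset U) (halt : Option U) :
    ℕ → Finset U → Timed (Finset U)
  | 0, X => pure X
  | n + 1, X => .after 1 do
      let c ← choose O X A
      match c with
      | none => pure X
      | some x =>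
        .after 1 <|
          if halt = some x then pure X
          else do
            let X' ← insertElt x X
            completeLoop O A halt n X'

/-- `COMPLETE(X, A)`. -/
def complete (O : BlackBox F) (X A : Finset U) : Timed (Finset U) := do
  let Y ← copySet X
  completeLoop O A none (Fintype.card U + 1) Y

/-- The truncated function `COMPLETE(X, A)|_w`. -/
def completeUntil (O : BlackBox F) (w : U) (X A : Finset U) : Timed (Finset U) := do
  let Y ← copySet X
  completeLoop O A (some w) (Fintype.card U + 1) Y

/-- The loop of `corePi`: `X` runs through the prefixes of the canonical order of `S`, and `r` is
the last pair of a prefix and its successor `x` in this order such that `CHOOSE(prefix, U) ≠ x`. -/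
def corePiLoop (O : BlackBox F) (S V : Finset U) :
    ℕ → Finset U → Option (Finset U × U) → Timed (Option (Finset U × U))
  | 0, _, r => pure r
  | n + 1, X, r => .after 1 do
      let c ← choose O X S
      match c with
      | none => pure r
      | some x =>
        let y ← choose O X V
        let r' ← .after 1 <|
          if y = some x then pure r
          else do
            let C ← copySet X
            pure (some (C, x))
        let X' ← insertElt x X
        corePiLoop O S V n X' r'

/-- `CORE(S)` and `PI(S)`, or `none` if `S` is a root, found in one run along the canonical order
of `S` rather than with one run of `COMPLETE` for each prefix. -/
def corePi (O : BlackBox F) (S : Finset U) : Timed (Option (Finset U × U)) := do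
  let t ← source O S
  match t with
  | none => pure none
  | some t =>
    let V ← fullSet
    let E ← emptySet
    let X ← insertElt t E
    corePiLoop O S V (Fintype.card U + 1) X none

/-- The body of the innermost loop of `CHILDREN(P, w)`, for a solution `R` of the restricted
problem and an element `s`: the set `S`, if it passes the test
`⟨PARENT(S), PI(S), R(S), SOURCE(S)⟩ = ⟨P, w, R, s⟩`. -/
def candidate (O : BlackBox F) (P : Finset U) (w : U) (R : Finset U) (s : U) :
    Timed (Option (Finset U)) := do
  let V ← fullSet
  let E ← emptySet
  let X ← insertElt s E
  let K ← completeUntil O w X R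
  let K' ← insertElt w K
  let S ← complete O K' V
  let cp ← corePi O S
  match cp with
  | none => pure none
  | some (C, v) =>
    let Q ← complete O C V
    let C' ← insertElt v C
    let Q₀ ← copySet Q
    let Q' ← insertElt v Q₀
    let R' ← complete O C' Q'
    let t ← source O S
    let b₁ ← sameSet Q P
    let b₂ ← sameElt v w
    let b₃ ← sameSet R' R
    .after 1 <|
      if b₁.down ∧ b₂.down ∧ b₃.down ∧ t = some s then pure (some S) else pure none

/-- Is `s ∈ (R ∩ Z) \ {w}`? -/
def isStart (O : BlackBox F) (R : Finset U) (w s : U) : Timed (ULift.{u} Bool) := do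
  let b ← contains s R
  if b.down then
    let c ← sameElt s w
    if c.down then pure ⟨false⟩ else isGood O s
  else pure ⟨false⟩

/-- The generator `CHILDREN(P, w)`. -/
def children (O : BlackBox F) (P : Finset U) (w : U) : Log U :=
  (contains w P).andThen fun inP =>
    if inP.down then []
    else (solveRestr O P w).andThen fun Rs =>
      forLog Rs fun R => (sameSet R P).andThen fun isP =>
        if isP.down then []
        else forLog (elems U) fun s => (isStart O R w s).andThen fun ok =>
          if ok.down then (candidate O P w R s).andThen fun res =>
            match res with
            | none => []
            | some S => [Event.emit S]
          else []

/-- The generator `ROOTS`: the sets `S = COMPLETE({s})`, `s ∈ Z`, with `SOURCE(S) = s`. If `Z` is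
empty then `∅` is the only solution, and it is a root. -/
def roots (O : BlackBox F) : Log U :=
  (findFirst (isGood O) (elems U)).andThen fun z =>
    match z with
    | none => [Event.emit ∅]
    | some _ => forLog (elems U) fun s => (isGood O s).andThen fun ok =>
      if ok.down then
        (do
          let V ← fullSet
          let E ← emptySet
          let X ← insertElt s E
          let S ← complete O X V
          let t ← source O S
          pure (S, t) : Timed (Finset U × Option U)).andThen fun r =>
            Event.work 1 :: if r.2 = some s then [Event.emit r.1] else []
      else []

/-- Writing an output takes `|U|` steps. -/
def outputSet (X : Finset U) : Log U := [Event.work (Fintype.card U), Event.emit X]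

/-- `SPAWN(X)` at depth `d`: output `X` at the beginning if `d` is odd, at the end if `d` is even,
and call `SPAWN(S)` for each `w ∈ U` and each `S` yielded by `CHILDREN(X, w)`. The first argument
bounds the nesting of recursive calls; the value is `none` if this bound is exceeded. -/
def spawn (O : BlackBox F) : ℕ → ℕ → Finset U → Option (Log U)
  | 0, _, _ => none
  | n + 1, d, X =>
    (expand (spawn O n (d + 1)) (forLog (elems U) fun w => children O X w)).map fun body =>
      (Event.work 1 :: if Odd d then outputSet X else []) ++ body ++
        if Even d then outputSet X else []

/-- The whole algorithm, with recursion bounded by `n`: `SPAWN(R)` for each `R ∈ ROOTS`, the roots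
having depth `0`. -/
def run (O : BlackBox F) (n : ℕ) : Option (Log U) := expand (spawn O n 0) (roots O)

/-- The algorithm terminates, and `l` is the record of its run. -/
def Terminates (O : BlackBox F) (l : Log U) : Prop := ∃ N, ∀ n ≥ N, run O n = some l

/-! The notions that the routines `choose` and `corePi` have to compute. -/

/-- `CHOOSE` returns the least element by (layer, label), and `none` if there is nothing to add. -/
def ChooseIsCorrect (O : BlackBox F) : Prop :=
  ∀ X ∈ F, ∀ t, IsSource F X t → ∀ A y,
    ((choose O X A).val = some y ↔ IsArgmin F X A t y) ∧
      ((choose O X A).val = none ↔ plus F X A = ∅)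

/-- The elements chosen successively by `COMPLETE(X, A)`, at most `n` of them. -/
def chosen (O : BlackBox F) (A : Finset U) : ℕ → Finset U → List U
  | 0, _ => []
  | n + 1, X =>
    match (choose O X A).val with
    | none => []
    | some x => x :: chosen O A n (insert x X)

/-- The canonical order of `S`, induced by `COMPLETE({SOURCE(S)}, S)`. -/
def canonicalOrder (O : BlackBox F) (S : Finset U) : List U :=
  match (source O S).val with
  | none => []
  | some t => t :: chosen O S (Fintype.card U) {t}

/-- `S[j]`: the first `j` elements of the canonical order of `S`. -/
def canonicalPrefix (O : BlackBox F) (S : Finset U) (j : ℕ) : Finset U :=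
  ((canonicalOrder O S).take j).toFinset

/-- `v = PI(S)` and `C = CORE(S)`: there is `j > 1` such that `v` is the `j`-th element of the
canonical order, `j` is the least index with `COMPLETE(S[j]) = S`, and `C = S[j-1]`. -/
def IsCorePi (O : BlackBox F) (S C : Finset U) (v : U) : Prop :=
  ∃ j > 1, (canonicalOrder O S)[j - 1]? = some v ∧ C = canonicalPrefix O S (j - 1) ∧
    (complete O (canonicalPrefix O S j) Finset.univ).val = S ∧
    ∀ i, 0 < i → i < j → (complete O (canonicalPrefix O S i) Finset.univ).val ≠ S

/-- `corePi` returns `CORE(S)` and `PI(S)`, and `none` for the roots, on maximal solutions `S`. -/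
def CorePiIsCorrect (O : BlackBox F) : Prop :=
  ∀ S, IsMaximalSol F S → ∀ C v, (corePi O S).val = some (C, v) ↔ IsCorePi O S C v

end Algorithm

end MaxEnum

set_option linter.unusedSectionVars false

namespace MaxEnum

/-! ### Commutable systems: layers, keys and initial segments -/

section SetSystemTheory

variable {U : Type u} [Fintype U] [LinearOrder U] {F : Finset (Finset U)}

/-! Everything rests on one consequence of commutability, `IsCommutable.insert_mem`: below a common
solution, an element addable to a nonempty solution stays addable to every larger one. Hence the
layers of a solution are solutions and exhaust it. Moreover the canonical order of `S` is the order
by `key` (layer, then label) measured in `S` itself, although `choose` only sees the layers of the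
current prefix: all layers below that of the next element lie inside the prefix, so prefix and `S`
agree on them (`IsSegment.isArgmin_of_isNext`). The prefixes are thus the initial segments of one
fixed order, and all of them are solutions.

When `choose` over all of `U` deviates from this order, it picks an element outside `S`. So
completing a prefix returns `S` exactly when no deviation occurs from there on (`complete_eq_iff`);
core and parent index are the last deviation, which a single run finds. An element that beats the
next one at some prefix keeps its key at later prefixes, so, if still addable after the parent
index, it would be chosen there (`IsCore.not_lt_next`). Therefore the parent index is not in the
parent, and inside any solution containing the core and the parent index `choose` retraces the core
(`IsCore.choose_eq`). This lets `children` rebuild `S` from its parent, where `R` is r(S) and `s` is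
the source.

Passing to the parent lowers the source, or keeps it and improves the set of keys lexicographically
(`IsCore.precedes`). The parent relation is therefore a forest over the roots, which gives
termination and completeness. The test in `children` makes `P`, `w`, `R` and `s` functions of `S`,
so nothing is repeated.

For the delay, outputs before the recursion at odd depth and after it at even depth leave the work
of at most two calls between outputs, besides the search for roots and the writing (`spawn_spec`,
`run_spec`). The work of one call is bounded by noting that loops over `U` do expensive work only
for members of a solution, of which there are at most q, and that each growing loop runs at most q +
1 times. -/

theorem mem_plus {X A : Finset U} {a : U} :
    a ∈ plus F X A ↔ a ∈ A ∧ a ∉ X ∧ insert a X ∈ F := by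
  simp [plus]

/-- Inside a solution, an element that can be added to `X` can be added to every larger
solution. -/
theorem IsCommutable.insert_mem (hF : IsCommutable F) {X X' Y : Finset U} {a : U}
    (hX : X ∈ F) (hX' : X' ∈ F) (hY : Y ∈ F) (hne : X.Nonempty) (h₁ : X ⊆ X') (h₂ : X' ⊆ Y)
    (ha : a ∈ Y) (haX : insert a X ∈ F) : insert a X' ∈ F := by
  classical
  by_cases haX' : a ∈ X'
  · rwa [Finset.insert_eq_of_mem haX']
  -- Take the largest `W` between `X` and `X'` to which `a` can be added. If it is not `X'`,
  -- accessibility supplies `z` from `X'`, and commutability makes `a` addable to the larger set as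
  -- well.
  obtain ⟨W, hW, hmax⟩ := Finset.exists_max_image
    (F.filter fun W => X ⊆ W ∧ W ⊆ X' ∧ insert a W ∈ F) Finset.card
    ⟨X, by simp [hX, h₁, haX]⟩
  simp only [Finset.mem_filter] at hW hmax
  obtain ⟨hWF, hXW, hWX', haW⟩ := hW
  by_cases hEq : W = X'
  · rwa [← hEq]
  obtain ⟨z, hz, hzF⟩ := hF.1.2 W hWF X' hX' (hWX'.ssubset_of_ne hEq)
  rw [Finset.mem_sdiff] at hz
  have haW' : a ∉ W := fun h => haX' (hWX' h)
  have hWY : W ⊂ Y := (hWX'.trans h₂).ssubset_of_ne (by rintro rfl; exact haW' ha)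
  have := hF.2 W hWF Y hY (hne.mono hXW) hWY a (by simp [ha, haW']) z
    (by simp [h₂ hz.1, hz.2]) haW hzF
  have h := hmax (insert z W) ⟨hzF, hXW.trans (Finset.subset_insert _ _),
    Finset.insert_subset hz.1 hWX', this⟩
  rw [Finset.card_insert_of_notMem hz.2] at h
  omega

theorem IsCommutable.union_mem (hF : IsCommutable F) {B Y T : Finset U}
    (hB : B ∈ F) (hY : Y ∈ F) (hne : B.Nonempty) (hBY : B ⊆ Y) (hT : T ⊆ plus F B Y) :
    B ∪ T ∈ F := by
  classical
  induction T using Finset.induction_on with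
  | empty => simpa
  | insert a T _ ih =>
    rw [Finset.insert_subset_iff, mem_plus] at hT
    rw [Finset.union_insert]
    refine hF.insert_mem hB (ih hT.2) hY hne Finset.subset_union_left
      (Finset.union_subset hBY fun x hx => (mem_plus.1 (hT.2 hx)).1) hT.1.1 hT.1.2.2

theorem IsStronglyAccessible.exists_isSource (hF : IsStronglyAccessible F) {X : Finset U}
    (hX : X ∈ F) (hne : X.Nonempty) : ∃ t, IsSource F X t := by
  classical
  obtain ⟨z, hz, hzF⟩ := hF.2 ∅ hF.1 X hX (Finset.empty_ssubset.2 hne)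
  have hne' : (X.filter fun x => {x} ∈ F).Nonempty := ⟨z, by simpa using ⟨by simpa using hz, hzF⟩⟩
  refine ⟨(X.filter fun x => {x} ∈ F).min' hne', ?_, fun x hx hxF => ?_⟩
  · simpa using Finset.min'_mem _ hne'
  · exact Finset.min'_le _ _ (by simp [hx, hxF])

theorem IsSource.unique {X : Finset U} {t t' : U} (h : IsSource F X t) (h' : IsSource F X t') :
    t = t' :=
  le_antisymm (h.2 _ h'.1.1 h'.1.2) (h'.2 _ h.1.1 h.1.2)

theorem IsSource.mono {X Y : Finset U} {t : U} (h : IsSource F Y t) (hXY : X ⊆ Y) (ht : t ∈ X) :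
    IsSource F X t :=
  ⟨⟨ht, h.1.2⟩, fun x hx hxF => h.2 x (hXY hx) hxF⟩

/-! ### Layers of a solution -/

section Layers

variable {X Y S : Finset U} {t y : U}

theorem layerSet_subset (ht : t ∈ X) (i : ℕ) : layerSet F X t i ⊆ X := by
  induction i with
  | zero => simpa [layerSet] using ht
  | succ i ih => exact Finset.union_subset ih fun x hx => (mem_plus.1 hx).1

theorem layerSet_mono : Monotone (layerSet F X t) :=
  monotone_nat_of_le_succ fun _ => Finset.subset_union_left

theorem start_mem_layerSet (i : ℕ) : t ∈ layerSet F X t i :=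
  layerSet_mono (Nat.zero_le i) (by simp [layerSet])

theorem IsCommutable.layerSet_mem (hF : IsCommutable F) (hX : X ∈ F) (ht : t ∈ X)
    (htF : {t} ∈ F) (i : ℕ) : layerSet F X t i ∈ F := by
  induction i with
  | zero => exact htF
  | succ i ih =>
    exact hF.union_mem ih hX ⟨t, start_mem_layerSet i⟩ (layerSet_subset ht i) subset_rfl

/-- By accessibility, every layer step strictly enlarges the set until all of `X` is reached, so
`X.card` steps are enough. -/
theorem IsCommutable.layerSet_eq (hF : IsCommutable F) (hX : X ∈ F) (ht : t ∈ X)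
    (htF : {t} ∈ F) {i : ℕ} (hi : X.card ≤ i) : layerSet F X t i = X := by
  have key : ∀ i, layerSet F X t i = X ∨ i < (layerSet F X t i).card := by
    intro i
    induction i with
    | zero => exact Or.inr (Finset.card_pos.2 ⟨t, start_mem_layerSet 0⟩)
    | succ i ih =>
      by_cases h : layerSet F X t i = X
      · have h' : layerSet F X t i ⊆ layerSet F X t (i + 1) := layerSet_mono (Nat.le_succ i)
        exact Or.inl (subset_antisymm (layerSet_subset ht _) (h.symm.subset.trans h'))
      · right
        obtain ⟨z, hz, hzF⟩ := hF.1.2 _ (hF.layerSet_mem hX ht htF i) X hX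
          ((layerSet_subset ht i).ssubset_of_ne h)
        rw [Finset.mem_sdiff] at hz
        have : layerSet F X t i ⊂ layerSet F X t (i + 1) := by
          refine (Finset.ssubset_iff_of_subset (layerSet_mono (Nat.le_succ i))).2 ⟨z, ?_, hz.2⟩
          exact Finset.mem_union_right _ (mem_plus.2 ⟨hz.1, hz.2, hzF⟩)
        have := Finset.card_lt_card this
        have := ih.resolve_left h
        omega
  rcases key i with h | h
  · exact h
  · exact Finset.eq_of_subset_of_card_le (layerSet_subset ht i) (by omega)

/-- If a layer of `S` lies inside `X ⊆ S`, then `X` and `S` have the same layers up to there. -/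
theorem layerSet_congr (hXS : X ⊆ S) {n : ℕ} (hn : layerSet F S t n ⊆ X) :
    ∀ i ≤ n, layerSet F X t i = layerSet F S t i := by
  intro i
  induction i with
  | zero => intro _; rfl
  | succ i ih =>
    intro hi
    have h := ih (by omega)
    simp only [layerSet, h]
    refine congrArg _ (Finset.ext fun x => ?_)
    simp only [mem_plus]
    refine ⟨fun hx => ⟨hXS hx.1, hx.2⟩, fun hx => ⟨hn (layerSet_mono hi ?_), hx.2⟩⟩
    exact Finset.mem_union_right _ (mem_plus.2 hx)

theorem lay_le {i : ℕ} (h : y ∈ plus F (layerSet F X t i) Finset.univ) : lay F X t y ≤ i + 1 :=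
  Nat.sInf_le ⟨Nat.succ_pos i, by simpa using h⟩

theorem lay_spec {i : ℕ} (h : y ∈ plus F (layerSet F X t i) Finset.univ) :
    0 < lay F X t y ∧ y ∈ plus F (layerSet F X t (lay F X t y - 1)) Finset.univ :=
  Nat.sInf_mem (s := {i | 0 < i ∧ y ∈ plus F (layerSet F X t (i - 1)) Finset.univ})
    ⟨i + 1, Nat.succ_pos i, by simpa using h⟩

theorem lay_spec_of_pos (h : 0 < lay F X t y) :
    y ∈ plus F (layerSet F X t (lay F X t y - 1)) Finset.univ :=
  (Nat.sInf_mem (Nat.nonempty_of_pos_sInf h) :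
    lay F X t y ∈ {i | 0 < i ∧ y ∈ plus F (layerSet F X t (i - 1)) Finset.univ}).2

/-- The start belongs to every layer set and is never addable, so the infimum is over the empty set
and takes its default value 0. This puts the start first in the order by `key`. -/
theorem lay_start : lay F X t t = 0 := by
  by_contra h
  exact (mem_plus.1 (lay_spec_of_pos (Nat.pos_of_ne_zero h))).2.1 (start_mem_layerSet _)

/-- The layer of `y` depends only on the layer sets with smaller index; agreement up to `n`
therefore fixes layers up to `n + 1`. -/
theorem lay_congr {n : ℕ} (h : ∀ i ≤ n, layerSet F X t i = layerSet F Y t i)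
    (hpos : 0 < lay F X t y) (hle : lay F X t y ≤ n + 1) : lay F Y t y = lay F X t y := by
  have h₁ := lay_spec_of_pos hpos
  rw [h _ (by omega)] at h₁
  have h₂ := lay_le h₁
  have h₃ := lay_spec h₁
  have h₄ := h₃.2
  rw [← h _ (by omega)] at h₄
  have := lay_le h₄
  omega

theorem IsCommutable.lay_pos_of_mem_plus (hF : IsCommutable F) (hX : X ∈ F) (ht : t ∈ X)
    (htF : {t} ∈ F) {A : Finset U} (hy : y ∈ plus F X A) :
    0 < lay F X t y ∧ lay F X t y ≤ X.card + 1 := by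
  have : y ∈ plus F (layerSet F X t X.card) Finset.univ := by
    rw [hF.layerSet_eq hX ht htF le_rfl]
    exact mem_plus.2 ⟨Finset.mem_univ _, (mem_plus.1 hy).2⟩
  exact ⟨(lay_spec this).1, lay_le this⟩

theorem lay_le_of_mem_layerSet {i : ℕ} (hy : y ∈ layerSet F X t i) : lay F X t y ≤ i := by
  induction i with
  | zero =>
    obtain rfl : y = t := by simpa [layerSet] using hy
    exact lay_start.le
  | succ i ih =>
    rcases Finset.mem_union.1 hy with h | h
    · exact (ih h).trans (Nat.le_succ i)
    · exact lay_le (mem_plus.2 ⟨Finset.mem_univ _, (mem_plus.1 h).2⟩)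

theorem IsCommutable.lay_pos_of_mem (hF : IsCommutable F) (hX : X ∈ F) (ht : t ∈ X)
    (htF : {t} ∈ F) (hy : y ∈ X) (hne : y ≠ t) : 0 < lay F X t y := by
  have key : ∀ i, y ∈ layerSet F X t i → 0 < lay F X t y := by
    intro i
    induction i with
    | zero => intro h; exact absurd (by simpa [layerSet] using h) hne
    | succ i ih =>
      intro h
      rcases Finset.mem_union.1 h with h | h
      · exact ih h
      · exact (lay_spec (mem_plus.2 ⟨Finset.mem_univ _, (mem_plus.1 h).2⟩)).1
  exact key X.card (by rwa [hF.layerSet_eq hX ht htF le_rfl])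

theorem IsCommutable.mem_layerSet_iff (hF : IsCommutable F) (hX : X ∈ F) (ht : t ∈ X)
    (htF : {t} ∈ F) (hy : y ∈ X) {i : ℕ} : y ∈ layerSet F X t i ↔ lay F X t y ≤ i := by
  refine ⟨lay_le_of_mem_layerSet, fun h => ?_⟩
  by_cases hne : y = t
  · exact hne ▸ start_mem_layerSet i
  have hpos := hF.lay_pos_of_mem hX ht htF hy hne
  have h₁ := mem_plus.1 (lay_spec_of_pos hpos)
  refine layerSet_mono h ?_
  obtain ⟨m, hm⟩ := Nat.exists_eq_add_of_lt hpos
  rw [zero_add] at hm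
  rw [hm]
  rw [hm, Nat.add_sub_cancel] at h₁
  exact Finset.mem_union_right _ (mem_plus.2 ⟨hy, h₁.2⟩)

end Layers

/-- The pair by which elements are compared relative to `X`. -/
noncomputable def key (F : Finset (Finset U)) (X : Finset U) (t y : U) : ℕ ×ₗ U :=
  toLex (lay F X t y, y)

theorem key_le_key {X Y : Finset U} {t y z : U} :
    key F X t y ≤ key F Y t z ↔
      lay F X t y < lay F Y t z ∨ lay F X t y = lay F Y t z ∧ y ≤ z :=
  Prod.Lex.le_iff

theorem key_lt_key {X Y : Finset U} {t y z : U} :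
    key F X t y < key F Y t z ↔
      lay F X t y < lay F Y t z ∨ lay F X t y = lay F Y t z ∧ y < z :=
  Prod.Lex.lt_iff

theorem key_injective {X : Finset U} {t : U} : Function.Injective (key F X t) := by
  intro y z h
  exact (Prod.ext_iff.1 (toLex.injective h)).2

theorem IsArgmin.key_le {X A : Finset U} {t y z : U} (h : IsArgmin F X A t y)
    (hz : z ∈ plus F X A) : key F X t y ≤ key F X t z := h.2 z hz

theorem IsArgmin.unique {X A : Finset U} {t y z : U} (h : IsArgmin F X A t y)
    (h' : IsArgmin F X A t z) : y = z :=
  key_injective (le_antisymm (h.2 z h'.1) (h'.2 y h.1))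

theorem IsArgmin.mono {X A A' : Finset U} {t y : U} (h : IsArgmin F X A t y) (hA : A' ⊆ A)
    (hy : y ∈ A') : IsArgmin F X A' t y :=
  ⟨mem_plus.2 ⟨hy, (mem_plus.1 h.1).2⟩,
    fun z hz => h.2 z (mem_plus.2 ⟨hA (mem_plus.1 hz).1, (mem_plus.1 hz).2⟩)⟩

/-- The initial segments of `S`, in the order of `key`, that contain `t`. -/
structure IsSegment (F : Finset (Finset U)) (S : Finset U) (t : U) (X : Finset U) : Prop where
  subset : X ⊆ S
  start_mem : t ∈ X
  key_lt : ∀ x ∈ X, ∀ y ∈ S, y ∉ X → key F S t x < key F S t y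

/-- `x` is the first element of `S` after the segment `X`. -/
def IsNext (F : Finset (Finset U)) (S : Finset U) (t : U) (X : Finset U) (x : U) : Prop :=
  (x ∈ S ∧ x ∉ X) ∧ ∀ y ∈ S, y ∉ X → key F S t x ≤ key F S t y

/-! ### Prefixes of the canonical order as initial segments -/

section Segments

variable {S X X' : Finset U} {t x y : U}

theorem IsSegment.exists_isNext (h : IsSegment F S t X) (hne : X ≠ S) :
    ∃ x, IsNext F S t X x := by
  obtain ⟨x, hx, hmin⟩ := Finset.exists_min_image (S \ X) (key F S t)
    (Finset.sdiff_nonempty.2 fun h' => hne (subset_antisymm h.subset h'))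
  rw [Finset.mem_sdiff] at hx
  exact ⟨x, hx, fun y hy hyX => hmin y (Finset.mem_sdiff.2 ⟨hy, hyX⟩)⟩

theorem IsSegment.total (h : IsSegment F S t X) (h' : IsSegment F S t X') :
    X ⊆ X' ∨ X' ⊆ X := by
  by_contra! hc
  obtain ⟨⟨a, ha, ha'⟩, ⟨b, hb, hb'⟩⟩ :=
    And.intro (Finset.not_subset.1 hc.1) (Finset.not_subset.1 hc.2)
  exact lt_asymm (h.key_lt a ha b (h'.subset hb) hb') (h'.key_lt b hb a (h.subset ha) ha')

theorem IsSegment.eq_of_card_eq (h : IsSegment F S t X) (h' : IsSegment F S t X')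
    (hc : X.card = X'.card) : X = X' := by
  rcases h.total h' with hs | hs
  · exact Finset.eq_of_subset_of_card_le hs hc.ge
  · exact (Finset.eq_of_subset_of_card_le hs hc.le).symm

theorem IsSegment.next_mem (h' : IsSegment F S t X')
    (hx : IsNext F S t X x) (hXX' : X ⊂ X') : x ∈ X' := by
  obtain ⟨z, hz, hzX⟩ := Finset.exists_of_ssubset hXX'
  by_contra hc
  exact absurd (h'.key_lt z hz x hx.1.1 hc) (not_lt.2 (hx.2 z (h'.subset hz) hzX))

theorem IsSegment.insert_next (h : IsSegment F S t X) (hx : IsNext F S t X x) :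
    IsSegment F S t (insert x X) where
  subset := Finset.insert_subset hx.1.1 h.subset
  start_mem := Finset.mem_insert_of_mem h.start_mem
  key_lt a ha y hy hyX := by
    rw [Finset.mem_insert, not_or] at hyX
    rcases Finset.mem_insert.1 ha with rfl | ha
    · exact (hx.2 y hy hyX.2).lt_of_ne fun hc => hyX.1 (key_injective hc).symm
    · exact h.key_lt a ha y hy hyX.2

theorem isSegment_singleton (hF : IsCommutable F) (hS : S ∈ F) (ht : t ∈ S) (htF : {t} ∈ F) :
    IsSegment F S t {t} where
  subset := by simpa using ht
  start_mem := by simp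
  key_lt a ha y hy hyt := by
    obtain rfl := Finset.mem_singleton.1 ha
    rw [Finset.mem_singleton] at hyt
    rw [key_lt_key, lay_start]
    exact Or.inl (hF.lay_pos_of_mem hS ht htF hy hyt)

theorem isSegment_self (ht : t ∈ S) : IsSegment F S t S :=
  ⟨subset_rfl, ht, fun _ _ _ hy hy' => absurd hy hy'⟩

theorem IsNext.ne_start (h : IsSegment F S t X) (hx : IsNext F S t X x) : x ≠ t := by
  rintro rfl
  exact hx.1.2 h.start_mem

/-- All layers before the one of the next element lie in the segment. -/
theorem IsSegment.layerSet_subset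
    (h : IsSegment F S t X) (hx : IsNext F S t X x) {i : ℕ} (hi : i < lay F S t x) :
    layerSet F S t i ⊆ X := by
  intro z hz
  have hzS := MaxEnum.layerSet_subset (h.subset h.start_mem) i hz
  by_contra hzX
  have h₁ := hx.2 z hzS hzX
  have h₂ := lay_le_of_mem_layerSet hz
  rw [key_le_key] at h₁
  omega

theorem IsSegment.layerSet_eq
    (h : IsSegment F S t X) (hx : IsNext F S t X x) {i : ℕ} (hi : i < lay F S t x) :
    layerSet F X t i = layerSet F S t i :=
  layerSet_congr h.subset (h.layerSet_subset hx hi) i le_rfl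

/-- With `B` the layer set just before the layer of the next element, `B ⊆ X`, and all elements of
`X` outside `B` have that same layer. Hence they are addable to `B` one by one and also all
together. -/
theorem IsSegment.mem (hF : IsCommutable F) (hS : S ∈ F) (htF : {t} ∈ F)
    (h : IsSegment F S t X) : X ∈ F := by
  by_cases hne : X = S
  · rwa [hne]
  obtain ⟨x, hx⟩ := h.exists_isNext hne
  have htS := h.subset h.start_mem
  have hpos := hF.lay_pos_of_mem hS htS htF hx.1.1 (hx.ne_start h)
  set B := layerSet F S t (lay F S t x - 1) with hB
  have hBX : B ⊆ X := h.layerSet_subset hx (by omega)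
  have := hF.union_mem (B := B) (Y := S) (T := X \ B) (hF.layerSet_mem hS htS htF _) hS
    ⟨t, start_mem_layerSet _⟩ (hBX.trans h.subset) (by
      intro z hz
      rw [Finset.mem_sdiff] at hz
      have hzS := h.subset hz.1
      have h₁ := h.key_lt z hz.1 x hx.1.1 hx.1.2
      have h₂ : ¬ lay F S t z ≤ lay F S t x - 1 := fun h' =>
        hz.2 ((hF.mem_layerSet_iff hS htS htF hzS).2 h')
      rw [key_lt_key] at h₁
      have h₃ : lay F S t z = lay F S t x := by omega
      have h₄ := lay_spec_of_pos (F := F) (X := S) (t := t) (y := z) (by omega)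
      rw [h₃] at h₄
      exact mem_plus.2 ⟨hzS, (mem_plus.1 h₄).2⟩)
  rwa [Finset.union_sdiff_of_subset hBX] at this

theorem IsSegment.lay_next (hF : IsCommutable F) (hS : S ∈ F) (htF : {t} ∈ F)
    (h : IsSegment F S t X) (hx : IsNext F S t X x) : lay F X t x = lay F S t x := by
  have hpos := hF.lay_pos_of_mem hS (h.subset h.start_mem) htF hx.1.1 (hx.ne_start h)
  refine lay_congr (n := lay F S t x - 1) (fun i hi => ?_) hpos (by omega)
  exact (h.layerSet_eq hx (by omega)).symm

theorem IsSegment.key_next (hF : IsCommutable F) (hS : S ∈ F) (htF : {t} ∈ F)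
    (h : IsSegment F S t X) (hx : IsNext F S t X x) : key F X t x = key F S t x := by
  simp only [key, h.lay_next hF hS htF hx]

/-- The greedy rule, which uses the layers of the current prefix, thus reproduces the static order
by keys in `S`. Prefix and `S` share all layer sets below the layer of `x`, so a competitor of no
larger layer has the same key in both. -/
theorem IsSegment.isArgmin_of_isNext (hF : IsCommutable F) (hS : S ∈ F) (htF : {t} ∈ F)
    (h : IsSegment F S t X) (hx : IsNext F S t X x) : IsArgmin F X S t x := by
  have htS := h.subset h.start_mem
  have hpos := hF.lay_pos_of_mem hS htS htF hx.1.1 (hx.ne_start h)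
  have hXF := h.mem hF hS htF
  refine ⟨mem_plus.2 ⟨hx.1.1, hx.1.2, ?_⟩, fun z hz => ?_⟩
  · exact hF.insert_mem (hF.layerSet_mem hS htS htF _) hXF hS ⟨t, start_mem_layerSet _⟩
      (h.layerSet_subset hx (i := lay F S t x - 1) (by omega)) h.subset hx.1.1
      (mem_plus.1 (lay_spec_of_pos hpos)).2.2
  · change key F X t x ≤ key F X t z
    have hzpos := hF.lay_pos_of_mem_plus hXF h.start_mem htF hz
    have hz' := mem_plus.1 hz
    have h₁ := hx.2 z hz'.1 hz'.2.1
    rw [h.key_next hF hS htF hx]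
    by_cases hc : lay F X t z ≤ lay F S t x
    · have : lay F S t z = lay F X t z :=
        lay_congr (n := lay F S t x - 1)
          (fun i hi => h.layerSet_eq hx (by omega)) hzpos.1 (by omega)
      rw [key_le_key] at h₁ ⊢
      rwa [← this]
    · rw [key_le_key]
      omega

theorem IsSegment.isNext_iff (hF : IsCommutable F) (hS : S ∈ F) (htF : {t} ∈ F)
    (h : IsSegment F S t X) : IsNext F S t X x ↔ IsArgmin F X S t x := by
  refine ⟨h.isArgmin_of_isNext hF hS htF, fun hx => ?_⟩
  have hx' := mem_plus.1 hx.1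
  obtain ⟨y, hy⟩ := h.exists_isNext fun hc => hx'.2.1 (hc ▸ hx'.1)
  rwa [hx.unique (h.isArgmin_of_isNext hF hS htF hy)]

/-- An element that precedes the next one at some segment still does so at every larger segment
to which it can be added. -/
theorem IsSegment.key_lt_next (hF : IsCommutable F) (hS : S ∈ F) (htF : {t} ∈ F)
    (h : IsSegment F S t X) (h' : IsSegment F S t X') (hXX' : X ⊆ X') {x' z : U}
    (hx : IsNext F S t X x) (hx' : IsNext F S t X' x') (hz : z ∈ plus F X Finset.univ)
    (hlt : key F X t z < key F X t x) : key F X' t z < key F X' t x' := by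
  have hle : key F S t x ≤ key F S t x' := hx.2 x' hx'.1.1 fun hc => hx'.1.2 (hXX' hc)
  rw [h'.key_next hF hS htF hx']
  rw [h.key_next hF hS htF hx] at hlt
  have hpos := hF.lay_pos_of_mem_plus (h.mem hF hS htF) h.start_mem htF hz
  have h₁ : lay F X t z ≤ lay F S t x := by rw [key_lt_key] at hlt; omega
  have h₂ : lay F S t x ≤ lay F S t x' := by rw [key_le_key] at hle; omega
  -- Both segments share with `S` the layer sets below the layer of `x`, and these already determine
  -- the layer of `z`. The next key, in turn, can only grow.
  have : lay F X' t z = lay F X t z :=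
    lay_congr (n := lay F S t x - 1) (fun i hi => by
      rw [h.layerSet_eq hx (by omega), h'.layerSet_eq hx' (by omega)])
      hpos.1 (by omega)
  have h₃ : key F X' t z = key F X t z := by simp only [key, this]
  rw [h₃]
  exact hlt.trans_le hle

end Segments

end SetSystemTheory

/-! ### Values of timed loops -/

section TimedLemmas

variable {α β σ : Type u}

@[simp] theorem Timed.val_pure (a : α) : (pure a : Timed α).val = a := rfl

@[simp] theorem Timed.time_pure (a : α) : (pure a : Timed α).time = 0 := rfl

@[simp] theorem Timed.val_bind (x : Timed α) (f : α → Timed β) :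
    (x >>= f).val = (f x.val).val := rfl

@[simp] theorem Timed.time_bind (x : Timed α) (f : α → Timed β) :
    (x >>= f).time = x.time + (f x.val).time := rfl

@[simp] theorem Timed.val_after (k : ℕ) (x : Timed α) : (Timed.after k x).val = x.val := rfl

@[simp] theorem Timed.time_after (k : ℕ) (x : Timed α) : (Timed.after k x).time = k + x.time := rfl

/-- The invariant refers to the list of elements already visited, most recent first; hence the
reversal in the conclusion. -/
theorem forEach_induction {body : σ → α → Timed σ} (P : List α → σ → Prop) {l : List α} {s : σ}
    (h₀ : P [] s) (h : ∀ v s a, P v s → P (a :: v) (body s a).val) :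
    P l.reverse (forEach body l s).val := by
  have key : ∀ l v s, P v s → P (l.reverse ++ v) (forEach body l s).val := by
    intro l
    induction l with
    | nil => intro v s hs; simpa [forEach] using hs
    | cons a l ih =>
      intro v s hs
      simpa [forEach] using ih (a :: v) _ (h v s a hs)
  simpa using key l [] s h₀

theorem findFirst_val (p : α → Timed (ULift Bool)) (l : List α) :
    (findFirst p l).val = l.find? fun a => (p a).val.down := by
  induction l with
  | nil => rfl
  | cons a l ih =>
    cases h : (p a).val.down <;> simp [findFirst, h, ih]

end TimedLemmas

/-! ### Values of `source`, `nextLayer` and `choose` -/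

section Values

variable {U : Type u} [Fintype U] [LinearOrder U] {F : Finset (Finset U)} {O : BlackBox F}

@[simp] theorem mem_elems (x : U) : x ∈ elems U := by simp [elems]

theorem elems_nodup : (elems U).Nodup := Finset.sort_nodup _ _

theorem elems_find?_eq_some {p : U → Bool} {t : U} :
    (elems U).find? p = some t ↔ p t = true ∧ ∀ x, p x = true → t ≤ x := by
  have hs : (elems U).Pairwise (· ≤ ·) := Finset.pairwise_sort _ _
  have key : ∀ l : List U, l.Pairwise (· ≤ ·) → ∀ t, l.find? p = some t →
      p t = true ∧ ∀ x ∈ l, p x = true → t ≤ x := by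
    intro l hl
    induction l with
    | nil => simp
    | cons a l ih =>
      intro t ht
      rw [List.pairwise_cons] at hl
      cases hp : p a with
      | true =>
        obtain rfl : a = t := by simpa [hp] using ht
        refine ⟨hp, fun x hx _ => ?_⟩
        rcases List.mem_cons.1 hx with rfl | hx
        · exact le_rfl
        · exact hl.1 x hx
      | false =>
        rw [List.find?_cons_of_neg (by simp [hp])] at ht
        refine ⟨(ih hl.2 t ht).1, fun x hx hpx => ?_⟩
        rcases List.mem_cons.1 hx with rfl | hx
        · simp [hp] at hpx
        · exact (ih hl.2 t ht).2 x hx hpx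
  refine ⟨fun h => ⟨(key _ hs t h).1, fun x => (key _ hs t h).2 x (mem_elems x)⟩, fun h => ?_⟩
  cases hf : (elems U).find? p with
  | none => exact absurd h.1 (by simpa using List.find?_eq_none.1 hf t (mem_elems t))
  | some t' =>
    have h' := key _ hs t' hf
    exact congrArg some (le_antisymm (h'.2 t (mem_elems t) h.1) (h.2 t' h'.1))

@[simp] theorem contains_val (x : U) (X : Finset U) : (contains x X).val.down = decide (x ∈ X) :=
  rfl

@[simp] theorem sameElt_val (x y : U) : (sameElt x y).val.down = decide (x = y) := rfl

@[simp] theorem insertElt_val (x : U) (X : Finset U) : (insertElt x X).val = insert x X := rfl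

@[simp] theorem emptySet_val : (emptySet : Timed (Finset U)).val = ∅ := rfl

@[simp] theorem fullSet_val : (fullSet : Timed (Finset U)).val = Finset.univ := rfl

@[simp] theorem copySet_val (X : Finset U) : (copySet X).val = X := rfl

@[simp] theorem sameSet_val (X Y : Finset U) : (sameSet X Y).val.down = decide (X = Y) := rfl

@[simp] theorem sizeOfSet_val (X : Finset U) : (sizeOfSet X).val.down = X.card := rfl

@[simp] theorem test_val (X : Finset U) : (test O X).val.down = decide (X ∈ F) := rfl

@[simp] theorem solveRestr_val (P : Finset U) (w : U) : (solveRestr O P w).val = O.restr P w := rfl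

@[simp] theorem canAdd_val (X : Finset U) (y : U) :
    (canAdd O X y).val.down = decide (y ∈ plus F X Finset.univ) := by
  by_cases h : y ∈ X <;> simp [canAdd, h, mem_plus]

@[simp] theorem isGood_val (x : U) : (isGood O x).val.down = decide ({x} ∈ F) := by
  simp [isGood]

theorem source_val_eq_some {X : Finset U} {t : U} :
    (source O X).val = some t ↔ IsSource F X t := by
  have h : ∀ x, (do
      let b ← contains x X
      if b.down then isGood O x else pure ⟨false⟩ : Timed (ULift.{u} Bool)).val.down =
        decide (x ∈ X ∧ {x} ∈ F) := by
    intro x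
    by_cases h : x ∈ X <;> simp [h]
  rw [source, findFirst_val, elems_find?_eq_some]
  simp only [h, decide_eq_true_eq, and_imp]
  rfl

theorem source_val_empty : (source O ∅).val = none := by
  cases h : (source O ∅).val with
  | none => rfl
  | some t => exact absurd (source_val_eq_some.1 h).1.1 (by simp)

theorem nextLayer_val (X B : Finset U) : (nextLayer O X B).val = B ∪ plus F B X := by
  have h := forEach_induction (body := fun C y => do
      let b ← contains y X
      if b.down then
        let c ← canAdd O B y
        if c.down then insertElt y C else pure C
      else pure C) (l := elems U) (s := B)
    -- Addability is tested against the fixed `B`, not the growing `C`, so the order of the visits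
    -- does not matter.
    (fun (v : List U) (C : Finset U) => C = B ∪ plus F B (X.filter (· ∈ v))) (by simp [plus])
    (by
      rintro v C y rfl
      ext z
      by_cases h₁ : y ∈ X
      · by_cases h₂ : y ∉ B ∧ insert y B ∈ F
        · simp [mem_plus, h₁, h₂]
          by_cases hz : z = y
          · subst hz; simp [h₁, h₂]
          · simp [hz]
        · simp [mem_plus, h₁, h₂]
          by_cases hz : z = y
          · subst hz; tauto
          · simp [hz]
      · simp [mem_plus, h₁]
        by_cases hz : z = y
        · subst hz; tauto
        · simp [hz])
  have h' := h
  simp only [List.mem_reverse, mem_elems, Finset.filter_true] at h'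
  exact h'

/-- Here `m` is the first index from `i` on at which `y` is addable. The list starts at index `i`,
so positions are counted from there, and `n` further sets must reach `m`. -/
theorem layerOf_layerSets_val (X : Finset U) (t y : U) (m : ℕ)
    (hm : y ∈ plus F (layerSet F X t m) Finset.univ) :
    ∀ n i, i ≤ m → m ≤ i + n → (∀ k, i ≤ k → k < m →
      y ∉ plus F (layerSet F X t k) Finset.univ) →
    (layerOf O y (layerSets O X n (layerSet F X t i)).val).val.down = ((m - i + 1 : ℕ) : WithTop ℕ) := by
  intro n
  induction n with
  | zero =>
    intro i h₁ h₂ _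
    obtain rfl : i = m := by omega
    simp [layerSets, layerOf, hm]
  | succ n ih =>
    intro i h₁ h₂ h₃
    rcases h₁.eq_or_lt with rfl | hlt
    · simp [layerSets, layerOf, hm]
    · have h₄ := ih (i + 1) hlt (by omega) fun k hk => h₃ k (by omega)
      have h₅ : layerSet F X t (i + 1) = (nextLayer O X (layerSet F X t i)).val := by
        rw [nextLayer_val]; rfl
      rw [h₅] at h₄
      simp only [layerSets, layerOf, Timed.val_after, Timed.val_bind, canAdd_val, Timed.val_pure,
        h₃ i le_rfl hlt, decide_false, Bool.false_eq_true, if_false, h₄]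
      norm_cast
      rw [show m - (i + 1) + 1 + 1 = m - i + 1 by omega]

theorem layerOf_val (hF : IsCommutable F) {X : Finset U} {t y : U} (hX : X ∈ F) (ht : t ∈ X)
    (htF : {t} ∈ F) (hy : y ∈ plus F X Finset.univ) :
    (layerOf O y (layerSets O X X.card {t}).val).val.down = ((lay F X t y : ℕ) : WithTop ℕ) := by
  have hpos := hF.lay_pos_of_mem_plus hX ht htF hy
  -- The first index at which `y` is addable is its layer minus one. That is at most `X.card`, so
  -- the list is long enough.
  have h := layerOf_layerSets_val (O := O) X t y (lay F X t y - 1) (lay_spec_of_pos hpos.1) X.card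
    0 (Nat.zero_le _) (by omega) (fun k _ hk hc => by have := lay_le hc; omega)
  rw [show lay F X t y - 1 - 0 + 1 = lay F X t y by omega] at h
  exact h

theorem choose_empty (A : Finset U) : (choose O ∅ A).val = none := by
  simp [choose, source_val_empty]

/-- The body of the last loop of `choose`, where `Bs` is the list of layers. -/
def chooseStep (O : BlackBox F) (X A : Finset U) (Bs : List (Finset U))
    (best : Option (ULift.{u} (WithTop ℕ) × U)) (y : U) :
    Timed (Option (ULift.{u} (WithTop ℕ) × U)) := do
  let a ← contains y A
  if a.down then
    let c ← canAdd O X y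
    if c.down then
      let l ← layerOf O y Bs
      .after 1 <| match best with
        | none => pure (some (l, y))
        | some (l', y') =>
          if l.down < l'.down ∨ (l.down = l'.down ∧ y < y') then pure (some (l, y))
          else pure best
    else pure best
  else pure best

theorem chooseStep_of_notMem {X A : Finset U} {Bs : List (Finset U)} {y : U}
    (best : Option (ULift.{u} (WithTop ℕ) × U)) (hy : y ∉ plus F X A) :
    (chooseStep O X A Bs best y).val = best := by
  by_cases hyA : y ∈ A
  · have : y ∉ plus F X Finset.univ := fun h => hy (mem_plus.2 ⟨hyA, (mem_plus.1 h).2⟩)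
    simp [chooseStep, hyA, this]
  · simp [chooseStep, hyA]

theorem chooseStep_of_mem {X A : Finset U} {Bs : List (Finset U)} {y : U}
    (best : Option (ULift.{u} (WithTop ℕ) × U)) (hy : y ∈ plus F X A) :
    (chooseStep O X A Bs best y).val = match best with
      | none => some ((layerOf O y Bs).val, y)
      | some (l', y') =>
        if (layerOf O y Bs).val.down < l'.down ∨
          ((layerOf O y Bs).val.down = l'.down ∧ y < y') then some ((layerOf O y Bs).val, y)
        else some (l', y') := by
  have : y ∈ plus F X Finset.univ := mem_plus.2 ⟨Finset.mem_univ _, (mem_plus.1 hy).2⟩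
  rcases best with _ | ⟨l', y'⟩
  · simp [chooseStep, (mem_plus.1 hy).1, this]
  · simp only [chooseStep, (mem_plus.1 hy).1, this, Timed.val_bind, contains_val, canAdd_val,
      decide_true, if_true, Timed.val_after]
    split_ifs <;> rfl

theorem choose_val_cases (hF : IsCommutable F) {X : Finset U} {t : U} (hX : X ∈ F)
    (ht : IsSource F X t) (A : Finset U) :
    ((choose O X A).val = none ∧ plus F X A = ∅) ∨
      ∃ y, (choose O X A).val = some y ∧ IsArgmin F X A t y := by
  have hs : (source O X).val = some t := source_val_eq_some.2 ht
  have h := forEach_induction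
    (body := chooseStep O X A (layerSets O X X.card {t}).val) (l := elems U) (s := none)
    -- Loop invariant: `best` holds the layer and the label of a minimizer of `key` among the
    -- visited candidates, or is empty if there were none.
    (fun (v : List U) best =>
      (best = none ∧ ∀ y ∈ v, y ∉ plus F X A) ∨
      ∃ y, best = some (⟨((lay F X t y : ℕ) : WithTop ℕ)⟩, y) ∧ y ∈ plus F X A ∧
        ∀ z ∈ v, z ∈ plus F X A → key F X t y ≤ key F X t z)
    (by simp)
    (by
      intro v best y hbest
      by_cases hy : y ∈ plus F X A
      · have hy' : y ∈ plus F X Finset.univ := mem_plus.2 ⟨Finset.mem_univ _, (mem_plus.1 hy).2⟩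
        have hl : (layerOf O y (layerSets O X X.card {t}).val).val =
          ⟨((lay F X t y : ℕ) : WithTop ℕ)⟩ :=
            ULift.down_injective (layerOf_val (O := O) hF hX ht.1.1 ht.1.2 hy')
        right
        rw [chooseStep_of_mem best hy, hl]
        rcases hbest with ⟨rfl, hv⟩ | ⟨y', rfl, hy'P, hv⟩
        · refine ⟨y, rfl, hy, fun z hz hzP => ?_⟩
          rcases List.mem_cons.1 hz with rfl | hz
          · exact le_rfl
          · exact absurd hzP (hv z hz)
        · have hcond : (((lay F X t y : ℕ) : WithTop ℕ) < ((lay F X t y' : ℕ) : WithTop ℕ) ∨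
              ((lay F X t y : ℕ) : WithTop ℕ) = ((lay F X t y' : ℕ) : WithTop ℕ) ∧ y < y') ↔
              key F X t y < key F X t y' := by
            rw [key_lt_key, Nat.cast_lt, Nat.cast_inj]
          simp only [hcond]
          by_cases hlt : key F X t y < key F X t y'
          · refine ⟨y, if_pos hlt, hy, fun z hz hzP => ?_⟩
            rcases List.mem_cons.1 hz with rfl | hz
            · exact le_rfl
            · exact hlt.le.trans (hv z hz hzP)
          · refine ⟨y', if_neg hlt, hy'P, fun z hz hzP => ?_⟩
            rcases List.mem_cons.1 hz with rfl | hz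
            · exact not_lt.1 hlt
            · exact hv z hz hzP
      · rw [chooseStep_of_notMem best hy]
        refine hbest.imp (fun h => ⟨h.1, ?_⟩) ?_
        · simpa [hy] using h.2
        · rintro ⟨y', h₁, h₂, h₃⟩
          refine ⟨y', h₁, h₂, fun z hz hzP => ?_⟩
          rcases List.mem_cons.1 hz with rfl | hz
          · exact absurd hzP hy
          · exact h₃ z hz hzP)
  have hval : (choose O X A).val = (forEach (chooseStep O X A (layerSets O X X.card {t}).val)
      (elems U) none).val.map Prod.snd := by
    simp only [choose, Timed.val_bind, hs, emptySet_val, insertElt_val, Timed.val_pure,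
      insert_empty_eq, sizeOfSet_val]
    rfl
  rw [hval]
  rcases h with ⟨h₁, h₂⟩ | ⟨y, h₁, h₂, h₃⟩
  · exact Or.inl ⟨by rw [h₁]; rfl, Finset.eq_empty_of_forall_notMem fun y => h₂ y (by simp)⟩
  · exact Or.inr ⟨y, by rw [h₁]; rfl, h₂, fun z hz => h₃ z (by simp) hz⟩

theorem choose_val_eq_some (hF : IsCommutable F) {X : Finset U} {t : U} (hX : X ∈ F)
    (ht : IsSource F X t) {A : Finset U} {y : U} :
    (choose O X A).val = some y ↔ IsArgmin F X A t y := by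
  rcases choose_val_cases (O := O) hF hX ht A with ⟨h₁, h₂⟩ | ⟨z, h₁, h₂⟩
  · simp only [h₁, reduceCtorEq, false_iff]
    intro h
    simpa [h₂] using h.1
  · rw [h₁, Option.some_inj]
    exact ⟨fun h => h ▸ h₂, fun h => h₂.unique h⟩

theorem choose_val_eq_none (hF : IsCommutable F) {X : Finset U} (hX : X ∈ F)
    (hne : X.Nonempty) {A : Finset U} :
    (choose O X A).val = none ↔ plus F X A = ∅ := by
  obtain ⟨t, ht⟩ := hF.1.exists_isSource hX hne
  rcases choose_val_cases (O := O) hF hX ht A with ⟨h₁, h₂⟩ | ⟨z, h₁, h₂⟩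
  · simp [h₁, h₂]
  · simp only [h₁, reduceCtorEq, false_iff]
    exact Finset.ne_empty_of_mem h₂.1

theorem chooseIsCorrect (hF : IsCommutable F) : ChooseIsCorrect O :=
  fun _ hX _ ht _ _ => ⟨choose_val_eq_some hF hX ht, choose_val_eq_none hF hX ⟨_, ht.1.1⟩⟩

theorem mem_plus_of_choose (hF : IsCommutable F) {X A : Finset U} {y : U} (hX : X ∈ F)
    (h : (choose O X A).val = some y) : y ∈ plus F X A := by
  rcases X.eq_empty_or_nonempty with rfl | hne
  · simp [choose_empty] at h
  · obtain ⟨t, ht⟩ := hF.1.exists_isSource hX hne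
    exact ((choose_val_eq_some hF hX ht).1 h).1

end Values

/-! ### Maximality as having nothing to add -/

section Maximal

variable {U : Type u} [Fintype U] [LinearOrder U] {F : Finset (Finset U)}

theorem IsMaximalSol.mem {S : Finset U} (h : IsMaximalSol F S) : S ∈ F := h.1

theorem IsMaximalSol.plus_eq_empty {S : Finset U} (h : IsMaximalSol F S) (A : Finset U) :
    plus F S A = ∅ := by
  refine Finset.eq_empty_of_forall_notMem fun a ha => ?_
  rw [mem_plus] at ha
  exact ha.2.1 (h.2.2 _ ha.2.2 (Finset.subset_univ _) (Finset.subset_insert _ _) ▸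
    Finset.mem_insert_self _ _)

theorem IsStronglyAccessible.eq_of_plus_eq_empty (hF : IsStronglyAccessible F) {X Y A : Finset U}
    (hX : X ∈ F) (hY : Y ∈ F) (hXY : X ⊆ Y) (hYA : Y ⊆ A) (h : plus F X A = ∅) : Y = X := by
  by_contra hne
  obtain ⟨z, hz, hzF⟩ := hF.2 X hX Y hY (hXY.ssubset_of_ne (Ne.symm hne))
  rw [Finset.mem_sdiff] at hz
  have : z ∈ plus F X A := mem_plus.2 ⟨hYA hz.1, hz.2, hzF⟩
  simp [h] at this

theorem IsStronglyAccessible.isMaximalIn (hF : IsStronglyAccessible F) {X A : Finset U}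
    (hX : X ∈ F) (hXA : X ⊆ A) (h : plus F X A = ∅) : IsMaximalIn F A X :=
  ⟨hX, hXA, fun _ hY hYA hXY => hF.eq_of_plus_eq_empty hX hY hXY hYA h⟩

end Maximal

/-! ### Completion, canonical order, core and parent index -/

section CompleteValues

variable {U : Type u} [Fintype U] [LinearOrder U] {F : Finset (Finset U)} {O : BlackBox F}

theorem completeLoop_succ_val (A : Finset U) (halt : Option U) (n : ℕ) (X : Finset U) :
    (completeLoop O A halt (n + 1) X).val =
      match (choose O X A).val with
      | none => X
      | some x => if halt = some x then X else (completeLoop O A halt n (insert x X)).val := by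
  simp only [completeLoop, Timed.val_after, Timed.val_bind]
  cases (choose O X A).val with
  | none => rfl
  | some x =>
    simp only [Timed.val_after]
    split_ifs <;> simp

/-- The fuel condition is preserved, since each round trades one unit of fuel for one new element.
It fails when no fuel is left, so the loop only stops for one of the two reasons in the last
disjunction. -/
theorem completeLoop_spec (hF : IsCommutable F) {A : Finset U} {halt : Option U} :
    ∀ n X, X ∈ F → X.Nonempty → Fintype.card U < n + X.card →
      let Y := (completeLoop O A halt n X).val
      Y ∈ F ∧ X ⊆ Y ∧ Y ⊆ X ∪ A ∧ ((∃ w, halt = some w ∧ w ∈ plus F Y A) ∨ plus F Y A = ∅) := by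
  intro n
  induction n with
  | zero =>
    intro X _ _ h
    have := Finset.card_le_univ X
    omega
  | succ n ih =>
    intro X hX hne h
    simp only [completeLoop_succ_val]
    cases hc : (choose O X A).val with
    | none =>
      exact ⟨hX, subset_rfl, Finset.subset_union_left,
        Or.inr ((choose_val_eq_none hF hX hne).1 hc)⟩
    | some x =>
      have hx := mem_plus_of_choose hF hX hc
      have hx' := mem_plus.1 hx
      by_cases hh : halt = some x
      · simp only [hh, if_true]
        exact ⟨hX, subset_rfl, Finset.subset_union_left, Or.inl ⟨x, rfl, hx⟩⟩
      · simp only [hh, if_false]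
        obtain ⟨h₁, h₂, h₃, h₄⟩ := ih (insert x X) hx'.2.2 (Finset.insert_nonempty _ _)
          (by rw [Finset.card_insert_of_notMem hx'.2.1]; omega)
        refine ⟨h₁, (Finset.subset_insert _ _).trans h₂, h₃.trans ?_, h₄⟩
        rw [Finset.insert_union]
        exact Finset.insert_subset (Finset.mem_union_right _ hx'.1) subset_rfl

theorem complete_val (X A : Finset U) :
    (complete O X A).val = (completeLoop O A none (Fintype.card U + 1) X).val := rfl

theorem completeUntil_val (w : U) (X A : Finset U) :
    (completeUntil O w X A).val = (completeLoop O A (some w) (Fintype.card U + 1) X).val := rfl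

section Complete

variable {X A : Finset U}

theorem complete_mem (hF : IsCommutable F) (hX : X ∈ F) (hne : X.Nonempty) :
    (complete O X A).val ∈ F :=
  (completeLoop_spec hF _ X hX hne (by omega)).1

theorem subset_complete (hF : IsCommutable F) (hX : X ∈ F) (hne : X.Nonempty) :
    X ⊆ (complete O X A).val :=
  (completeLoop_spec hF _ X hX hne (by omega)).2.1

theorem isMaximalIn_complete (hF : IsCommutable F) (hX : X ∈ F) (hne : X.Nonempty)
    (hXA : X ⊆ A) : IsMaximalIn F A (complete O X A).val := by
  obtain ⟨h₁, _, h₃, h₄⟩ := completeLoop_spec (O := O) (A := A) (halt := none) hF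
    (Fintype.card U + 1) X hX hne (by omega)
  rcases h₄ with ⟨w, hw, -⟩ | h₄
  · cases hw
  · exact hF.1.isMaximalIn h₁ (h₃.trans (Finset.union_subset hXA subset_rfl)) h₄

theorem isMaximalSol_complete (hF : IsCommutable F) (hX : X ∈ F) (hne : X.Nonempty) :
    IsMaximalSol F (complete O X Finset.univ).val :=
  isMaximalIn_complete hF hX hne (Finset.subset_univ _)

/-- Either the run stopped because `w` was chosen, so `w` is addable, or it exhausted the solution
`A`, which already contains `w`. This makes the second completion in `candidate` start from a
solution. -/
theorem insert_completeUntil_mem (hF : IsCommutable F) {w : U} (hX : X ∈ F) (hne : X.Nonempty)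
    (hXA : X ⊆ A) (hA : A ∈ F) (hw : w ∈ A) :
    insert w (completeUntil O w X A).val ∈ F := by
  obtain ⟨h₁, _, h₃, h₄⟩ := completeLoop_spec (O := O) (A := A) (halt := some w) hF
    (Fintype.card U + 1) X hX hne (by omega)
  rw [← completeUntil_val] at h₁ h₃ h₄
  rcases h₄ with ⟨w', hw', h₄⟩ | h₄
  · obtain rfl := Option.some_injective _ hw'
    exact (mem_plus.1 h₄).2.2
  · have := hF.1.eq_of_plus_eq_empty h₁ hA (h₃.trans (Finset.union_subset hXA subset_rfl))
      subset_rfl h₄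
    rwa [← this, Finset.insert_eq_of_mem hw]

end Complete

section CanonicalOrder

variable {S X C : Finset U} {t x v : U}

theorem IsNext.unique {x' : U} (h : IsNext F S t X x) (h' : IsNext F S t X x') : x = x' :=
  key_injective (le_antisymm (h.2 _ h'.1.1 h'.1.2) (h'.2 _ h.1.1 h.1.2))

theorem IsNext.ne (h : IsNext F S t X x) : X ≠ S := by
  rintro rfl
  exact h.1.2 h.1.1

theorem IsSegment.isSource (h : IsSegment F S t X) (ht : IsSource F S t) : IsSource F X t :=
  ht.mono h.subset h.start_mem

theorem IsSegment.choose_eq_some (hF : IsCommutable F) (hS : S ∈ F) (ht : IsSource F S t)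
    (h : IsSegment F S t X) : (choose O X S).val = some x ↔ IsNext F S t X x := by
  rw [h.isNext_iff hF hS ht.1.2,
    choose_val_eq_some hF (h.mem hF hS ht.1.2) (h.isSource ht)]

theorem choose_self (hF : IsCommutable F) (hS : S ∈ F) (ht : IsSource F S t) :
    (choose O S S).val = none := by
  cases hc : (choose O S S).val with
  | none => rfl
  | some x => exact ((((isSegment_self ht.1.1).choose_eq_some hF hS ht).1 hc).ne rfl).elim

/-- Where `choose` with all of `U` available leaves `S`, it picks an element outside `S`. -/
theorem IsSegment.notMem_of_choose (hF : IsCommutable F) (hS : S ∈ F) (ht : IsSource F S t)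
    (h : IsSegment F S t X) (hx : IsNext F S t X x) {y : U}
    (hy : (choose O X Finset.univ).val = some y) (hyx : y ≠ x) : y ∉ S := by
  intro hyS
  have hXF := h.mem hF hS ht.1.2
  have := ((choose_val_eq_some hF hXF (h.isSource ht)).1 hy).mono (Finset.subset_univ S) hyS
  exact hyx (this.unique (h.isArgmin_of_isNext hF hS ht.1.2 hx))

theorem IsSegment.exists_choose (hF : IsCommutable F) (hS : S ∈ F) (ht : IsSource F S t)
    (h : IsSegment F S t X) (hx : IsNext F S t X x) {A : Finset U} (hA : x ∈ A) :
    ∃ y, (choose O X A).val = some y ∧ IsArgmin F X A t y := by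
  have hXF := h.mem hF hS ht.1.2
  rcases choose_val_cases (O := O) hF hXF (h.isSource ht) A with ⟨_, h₂⟩ | h₁
  · have := (h.isArgmin_of_isNext hF hS ht.1.2 hx).1
    have : x ∈ plus F X A := mem_plus.2 ⟨hA, (mem_plus.1 this).2⟩
    simp [h₂] at this
  · exact h₁

/-- From the segment `X` on, `choose` with all of `U` available follows the canonical order. -/
def Follows (O : BlackBox F) (S : Finset U) (t : U) (X : Finset U) : Prop :=
  ∀ X' x, IsSegment F S t X' → X ⊆ X' → IsNext F S t X' x →
    (choose O X' Finset.univ).val = some x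

theorem IsSegment.follows_iff (h : IsSegment F S t X) (hx : IsNext F S t X x) :
    Follows O S t X ↔
      (choose O X Finset.univ).val = some x ∧ Follows O S t (insert x X) := by
  refine ⟨fun hf => ⟨hf X x h subset_rfl hx,
    fun X' x' h' hs => hf X' x' h' ((Finset.subset_insert _ _).trans hs)⟩, fun hf X' x' h' hs hx' => ?_⟩
  rcases hs.eq_or_ssubset with rfl | hs
  · rw [hx'.unique hx, hf.1]
  · exact hf.2 X' x' h' (Finset.insert_subset (h'.next_mem hx hs) hs.subset) hx'

theorem follows_self : Follows O S t S := fun _ _ h' hs hx' =>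
  absurd (subset_antisymm h'.subset hs) hx'.ne

/-- A first deviation from the canonical order picks an element outside `S`, and completion never
drops an element again. -/
theorem completeLoop_eq_iff (hF : IsCommutable F) (hS : IsMaximalSol F S) (ht : IsSource F S t) :
    ∀ n X, IsSegment F S t X → Fintype.card U < n + X.card →
      ((completeLoop O Finset.univ none n X).val = S ↔ Follows O S t X) := by
  intro n
  induction n with
  | zero =>
    intro X _ h
    have := Finset.card_le_univ X
    omega
  | succ n ih =>
    intro X hX h
    by_cases hXS : X = S
    · subst hXS
      have : (choose O X Finset.univ).val = none :=
        (choose_val_eq_none hF hS.mem ⟨t, ht.1.1⟩).2 (hS.plus_eq_empty _)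
      simp [completeLoop_succ_val, this, follows_self]
    · obtain ⟨x, hx⟩ := hX.exists_isNext hXS
      obtain ⟨y, hy, hyA⟩ := hX.exists_choose (O := O) hF hS.mem ht hx (Finset.mem_univ x)
      have hcard : Fintype.card U < n + (insert y X).card := by
        rw [Finset.card_insert_of_notMem (mem_plus.1 hyA.1).2.1]; omega
      rw [hX.follows_iff hx, completeLoop_succ_val, hy]
      by_cases hyx : y = x
      · subst hyx
        simpa using ih (insert y X) (hX.insert_next hx) hcard
      · have hyS := hX.notMem_of_choose hF hS.mem ht hx hy hyx
        simp only [reduceCtorEq, if_false, Option.some_inj, hyx, false_and, iff_false]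
        intro hc
        have := (completeLoop_spec (O := O) (A := Finset.univ) (halt := none) hF n (insert y X)
          (mem_plus.1 hyA.1).2.2 (Finset.insert_nonempty _ _) hcard).2.1
        rw [hc] at this
        exact hyS (this (Finset.mem_insert_self _ _))

theorem complete_eq_iff (hF : IsCommutable F) (hS : IsMaximalSol F S) (ht : IsSource F S t)
    (hX : IsSegment F S t X) : (complete O X Finset.univ).val = S ↔ Follows O S t X :=
  completeLoop_eq_iff hF hS ht _ X hX (by omega)

/-- `C` is the last segment of `S` at which `choose` with all of `U` available leaves `S`, and
`v` is the next element. -/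
structure IsCore (O : BlackBox F) (S : Finset U) (t : U) (C : Finset U) (v : U) : Prop where
  segment : IsSegment F S t C
  next : IsNext F S t C v
  choose_ne : (choose O C Finset.univ).val ≠ some v
  follows : Follows O S t (insert v C)

theorem IsCore.not_follows (h : IsCore O S t C v) (hs : X ⊆ C) : ¬ Follows O S t X :=
  fun hf => h.choose_ne (hf C v h.segment hs h.next)

theorem IsCore.unique {C' : Finset U} {v' : U} (h : IsCore O S t C v) (h' : IsCore O S t C' v') :
    C = C' ∧ v = v' := by
  have key : ∀ {C C' : Finset U} {v v' : U}, IsCore O S t C v → IsCore O S t C' v' →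
      C ⊆ C' → C = C' := by
    intro C C' v v' h h' hs
    by_contra hne
    -- A strictly later deviation at `C'` would contradict that no deviation occurs after `C`.
    exact h'.choose_ne (h.follows C' v' h'.segment
      (Finset.insert_subset (h'.segment.next_mem h.next (hs.ssubset_of_ne hne)) hs) h'.next)
  have hC : C = C' := by
    rcases h.segment.total h'.segment with hs | hs
    · exact key h h' hs
    · exact (key h' h hs).symm
  subst hC
  exact ⟨rfl, h.next.unique h'.next⟩

theorem corePiLoop_succ_val (V : Finset U) (n : ℕ) (r : Option (Finset U × U)) :
    (corePiLoop O S V (n + 1) X r).val =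
      match (choose O X S).val with
      | none => r
      | some x => (corePiLoop O S V n (insert x X)
          (if (choose O X V).val = some x then r else some (X, x))).val := by
  simp only [corePiLoop, Timed.val_after, Timed.val_bind]
  cases (choose O X S).val with
  | none => rfl
  | some x =>
    simp only [Timed.val_bind, Timed.val_after, insertElt_val]
    split_ifs <;> simp

/-- The accumulator is overwritten at each deviation, so at the end it holds the last one, or its
initial value if there was none from `X` on. -/
theorem corePiLoop_spec (hF : IsCommutable F) (hS : S ∈ F) (ht : IsSource F S t) :
    ∀ n X r, IsSegment F S t X → Fintype.card U < n + X.card →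
      let r' := (corePiLoop O S Finset.univ n X r).val
      (r' = r ∧ Follows O S t X) ∨ ∃ C v, r' = some (C, v) ∧ IsCore O S t C v ∧ X ⊆ C := by
  intro n
  induction n with
  | zero =>
    intro X _ _ h
    have := Finset.card_le_univ X
    omega
  | succ n ih =>
    intro X r hX h
    simp only [corePiLoop_succ_val]
    by_cases hXS : X = S
    · subst hXS
      simp [choose_self hF hS ht, follows_self]
    · obtain ⟨x, hx⟩ := hX.exists_isNext hXS
      rw [(hX.choose_eq_some hF hS ht).2 hx]
      have hcard : Fintype.card U < n + (insert x X).card := by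
        rw [Finset.card_insert_of_notMem hx.1.2]; omega
      rcases ih (insert x X) (if (choose O X Finset.univ).val = some x then r else some (X, x))
        (hX.insert_next hx) hcard with ⟨h₁, h₂⟩ | ⟨C, v, h₁, h₂, h₃⟩
      · by_cases hc : (choose O X Finset.univ).val = some x
        · left
          simp only [h₁]
          exact ⟨if_pos hc, (hX.follows_iff hx).2 ⟨hc, h₂⟩⟩
        · right
          simp only [h₁]
          exact ⟨X, x, if_neg hc, ⟨hX, hx, hc, h₂⟩, subset_rfl⟩
      · exact Or.inr ⟨C, v, h₁, h₂, (Finset.subset_insert _ _).trans h₃⟩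

theorem corePi_val_eq_none_of_source (h : (source O S).val = none) :
    (corePi O S).val = none := by
  simp [corePi, h]

theorem corePi_val (h : (source O S).val = some t) :
    (corePi O S).val =
      (corePiLoop O S Finset.univ (Fintype.card U + 1) {t} none).val := by
  simp [corePi, h]

theorem corePi_cases (hF : IsCommutable F) (hS : S ∈ F) (ht : IsSource F S t) :
    ((corePi O S).val = none ∧ Follows O S t {t}) ∨
      ∃ C v, (corePi O S).val = some (C, v) ∧ IsCore O S t C v := by
  rw [corePi_val (source_val_eq_some.2 ht)]
  rcases corePiLoop_spec (O := O) hF hS ht (Fintype.card U + 1) {t} none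
    (isSegment_singleton hF hS ht.1.1 ht.1.2) (by omega) with h | ⟨C, v, h₁, h₂, _⟩
  · exact Or.inl h
  · exact Or.inr ⟨C, v, h₁, h₂⟩

theorem corePi_val_eq_some (hF : IsCommutable F) (hS : S ∈ F) (ht : IsSource F S t) :
    (corePi O S).val = some (C, v) ↔ IsCore O S t C v := by
  rcases corePi_cases (O := O) hF hS ht with ⟨h₁, h₂⟩ | ⟨C', v', h₁, h₂⟩
  · simp only [h₁, reduceCtorEq, false_iff]
    exact fun h => h.not_follows (by simpa using h.segment.start_mem) h₂
  · rw [h₁, Option.some_inj, Prod.mk.injEq]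
    refine ⟨?_, fun h => h₂.unique h⟩
    rintro ⟨rfl, rfl⟩
    exact h₂

theorem corePi_val_eq_none (hF : IsCommutable F) (hS : S ∈ F) (ht : IsSource F S t) :
    (corePi O S).val = none ↔ Follows O S t {t} := by
  rcases corePi_cases (O := O) hF hS ht with ⟨h₁, h₂⟩ | ⟨C', v', h₁, h₂⟩
  · simp [h₁, h₂]
  · simp only [h₁, reduceCtorEq, false_iff]
    exact h₂.not_follows (by simpa using h₂.segment.start_mem)

/-- Including the end `X.card + i = S.card` matters: there no next element exists, so the list is
exhausted. This yields the bound on the length of the canonical order. -/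
theorem chosen_spec (hF : IsCommutable F) (hS : S ∈ F) (ht : IsSource F S t) :
    ∀ n X, IsSegment F S t X → S.card ≤ X.card + n → ∀ i, X.card + i ≤ S.card →
      IsSegment F S t (X ∪ ((chosen O S n X).take i).toFinset) ∧
      (X ∪ ((chosen O S n X).take i).toFinset).card = X.card + i ∧
      ∀ x, (chosen O S n X)[i]? = some x ↔
        IsNext F S t (X ∪ ((chosen O S n X).take i).toFinset) x := by
  intro n
  induction n with
  | zero =>
    intro X hX h i hi
    obtain rfl : X = S := Finset.eq_of_subset_of_card_le hX.subset (by omega)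
    obtain rfl : i = 0 := by omega
    simpa [chosen, hX] using fun x hx => hx.ne rfl
  | succ n ih =>
    intro X hX h i hi
    by_cases hXS : X = S
    · subst hXS
      obtain rfl : i = 0 := by omega
      simpa [chosen, hX, choose_self hF hS ht] using fun x hx => hx.ne rfl
    · obtain ⟨x, hx⟩ := hX.exists_isNext hXS
      have hch : chosen O S (n + 1) X = x :: chosen O S n (insert x X) := by
        rw [chosen, (hX.choose_eq_some hF hS ht).2 hx]
      rw [hch]
      cases i with
      | zero =>
        simp only [List.take_zero, List.toFinset_nil, Finset.union_empty, add_zero,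
          List.getElem?_cons_zero, Option.some_inj, true_and, hX]
        exact fun y => ⟨fun h => h ▸ hx, fun h => hx.unique h⟩
      | succ i =>
        have hcard := Finset.card_insert_of_notMem hx.1.2
        have := ih (insert x X) (hX.insert_next hx) (by omega) i (by omega)
        rw [hcard] at this
        simp only [List.take_succ_cons, List.toFinset_cons, Finset.union_insert,
          List.getElem?_cons_succ]
        rw [Finset.insert_union] at this
        refine ⟨this.1, this.2.1.trans (by omega), this.2.2⟩

theorem canonicalPrefix_spec (hF : IsCommutable F) (hS : S ∈ F) (ht : IsSource F S t) {j : ℕ}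
    (hj : 0 < j) (hjS : j ≤ S.card) :
    IsSegment F S t (canonicalPrefix O S j) ∧ (canonicalPrefix O S j).card = j ∧
      ∀ x, (canonicalOrder O S)[j]? = some x ↔ IsNext F S t (canonicalPrefix O S j) x := by
  obtain ⟨i, rfl⟩ := Nat.exists_eq_succ_of_ne_zero hj.ne'
  have h := chosen_spec (O := O) hF hS ht (Fintype.card U) {t}
    (isSegment_singleton hF hS ht.1.1 ht.1.2)
    ((Finset.card_le_univ S).trans (Nat.le_add_left _ _)) i (by simp; omega)
  simp only [canonicalPrefix, canonicalOrder, source_val_eq_some.2 ht, Nat.succ_eq_add_one,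
    List.take_succ_cons, List.toFinset_cons, List.getElem?_cons_succ]
  rw [← Finset.insert_eq] at h
  exact ⟨h.1, h.2.1.trans (by simp; omega), h.2.2⟩

theorem length_canonicalOrder_le (hF : IsCommutable F) (hS : S ∈ F) (ht : IsSource F S t) :
    (canonicalOrder O S).length ≤ S.card := by
  have hpos : 0 < S.card := Finset.card_pos.2 ⟨t, ht.1.1⟩
  obtain ⟨h₁, h₂, h₃⟩ := canonicalPrefix_spec (O := O) hF hS ht hpos le_rfl
  have hEq := Finset.eq_of_subset_of_card_le h₁.subset h₂.ge
  rw [← List.getElem?_eq_none_iff, Option.eq_none_iff_forall_ne_some]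
  exact fun x hx => ((h₃ x).1 hx).ne hEq

/-- Following the canonical order is inherited by longer prefixes, so the least prefix that
completes to `S` comes right after the last deviation. -/
theorem isCorePi_iff (hF : IsCommutable F) (hS : IsMaximalSol F S) (ht : IsSource F S t) :
    IsCorePi O S C v ↔ IsCore O S t C v := by
  constructor
  · rintro ⟨j, hj, hv, rfl, h₁, h₂⟩
    have hjS : j - 1 < S.card :=
      ((List.getElem?_eq_some_iff.1 hv).1).trans_le (length_canonicalOrder_le hF hS.mem ht)
    obtain ⟨hseg, hcard, hnext⟩ := canonicalPrefix_spec (O := O) hF hS.mem ht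
      (j := j - 1) (by omega) hjS.le
    obtain ⟨hseg', hcard', -⟩ := canonicalPrefix_spec (O := O) hF hS.mem ht
      (j := j) (by omega) (by omega)
    have hvn := (hnext v).1 hv
    have hEq : canonicalPrefix O S j = insert v (canonicalPrefix O S (j - 1)) := by
      refine hseg'.eq_of_card_eq (hseg.insert_next hvn) ?_
      rw [Finset.card_insert_of_notMem hvn.1.2]
      omega
    -- Minimality of `j` is needed only at `j - 1`: completion fails there but succeeds one step
    -- later, so the deviation occurs exactly at this prefix.
    have h₃ := h₂ (j - 1) (by omega) (by omega)
    rw [hEq, complete_eq_iff hF hS ht (hseg.insert_next hvn)] at h₁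
    rw [Ne, complete_eq_iff hF hS ht hseg, hseg.follows_iff hvn] at h₃
    exact ⟨hseg, hvn, fun hc => h₃ ⟨hc, h₁⟩, h₁⟩
  · intro h
    have hpos : 0 < C.card := Finset.card_pos.2 ⟨t, h.segment.start_mem⟩
    have hlt : C.card < S.card :=
      Finset.card_lt_card (h.segment.subset.ssubset_of_ne h.next.ne)
    have hpre : ∀ {i X}, IsSegment F S t X → X.card = i → 0 < i → canonicalPrefix O S i = X := by
      intro i X hX hi hi0
      obtain ⟨hseg, hcard, -⟩ := canonicalPrefix_spec (O := O) hF hS.mem ht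
        (j := i) hi0 (hi ▸ Finset.card_le_card hX.subset)
      exact hseg.eq_of_card_eq hX (hcard.trans hi.symm)
    have hC := hpre h.segment rfl hpos
    refine ⟨C.card + 1, by omega, ?_, ?_, ?_, ?_⟩
    · rw [Nat.add_sub_cancel, (canonicalPrefix_spec hF hS.mem ht hpos hlt.le).2.2, hC]
      exact h.next
    · rw [Nat.add_sub_cancel, hC]
    · have hins := h.segment.insert_next h.next
      rw [hpre hins (Finset.card_insert_of_notMem h.next.1.2) (Nat.succ_pos _),
        complete_eq_iff hF hS ht hins]
      exact h.follows
    · intro i hi hlt'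
      obtain ⟨hseg, hcard, -⟩ := canonicalPrefix_spec (O := O) hF hS.mem ht
        (j := i) hi (by omega)
      rw [Ne, complete_eq_iff hF hS ht hseg]
      refine h.not_follows ?_
      rcases hseg.total h.segment with hs | hs
      · exact hs
      · exact (Finset.eq_of_subset_of_card_le hs (by omega)).symm.subset

theorem corePiIsCorrect (hF : IsCommutable F) : CorePiIsCorrect O := by
  intro S hS C v
  rcases S.eq_empty_or_nonempty with rfl | hne
  · rw [corePi_val_eq_none_of_source source_val_empty]
    simp [IsCorePi, canonicalOrder, source_val_empty]
  · obtain ⟨t, ht⟩ := hF.1.exists_isSource hS.mem hne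
    rw [isCorePi_iff hF hS ht, corePi_val_eq_some hF hS.mem ht]

end CanonicalOrder

end CompleteValues

/-! ### Progress towards the roots, and recovery of a solution from its parent -/

section Parent

variable {U : Type u} [Fintype U] [LinearOrder U] {F : Finset (Finset U)} {O : BlackBox F}

section Progress

/-- The elements of `X` with their layers, the earlier ones being larger. -/
noncomputable def keySet (F : Finset (Finset U)) (X : Finset U) (t : U) :
    Finset (ℕ ×ₗ U)ᵒᵈ :=
  X.image fun x => OrderDual.toDual (key F X t x)

theorem mem_keySet {X : Finset U} {t : U} {a : ℕ ×ₗ U} :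
    OrderDual.toDual a ∈ keySet F X t ↔ ∃ x ∈ X, key F X t x = a := by
  simp [keySet]

theorem key_mem_keySet {X : Finset U} {t x : U} (hx : x ∈ X) :
    OrderDual.toDual (key F X t x) ∈ keySet F X t := mem_keySet.2 ⟨x, hx, rfl⟩

theorem eq_of_key_eq {X Y : Finset U} {t x y : U} (h : key F X t x = key F Y t y) : x = y :=
  (Prod.ext_iff.1 (toLex.injective h)).2

theorem lay_eq_of_key_eq {X Y : Finset U} {t x y : U} (h : key F X t x = key F Y t y) :
    lay F X t x = lay F Y t y :=
  (Prod.ext_iff.1 (toLex.injective h)).1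

/-- The order in which the source, and then the canonical order, of the solutions improves. -/
def Precedes (F : Finset (Finset U)) (P S : Finset U) : Prop :=
  ∃ p s, IsSource F P p ∧ IsSource F S s ∧
    (p < s ∨ p = s ∧ toColex (keySet F S s) < toColex (keySet F P p))

theorem not_precedes_self (P : Finset U) : ¬ Precedes F P P := by
  rintro ⟨p, s, hp, hs, h⟩
  obtain rfl := hp.unique hs
  simp at h

theorem Precedes.trans {P Q S : Finset U} (h₁ : Precedes F P Q) (h₂ : Precedes F Q S) :
    Precedes F P S := by
  obtain ⟨p, q, hp, hq, h₁⟩ := h₁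
  obtain ⟨q', s, hq', hs, h₂⟩ := h₂
  obtain rfl := hq.unique hq'
  refine ⟨p, s, hp, hs, ?_⟩
  rcases h₁ with h₁ | ⟨rfl, h₁⟩
  · rcases h₂ with h₂ | ⟨rfl, -⟩
    · exact Or.inl (h₁.trans h₂)
    · exact Or.inl h₁
  · exact h₂.imp_right fun h => ⟨h.1, h.2.trans h₁⟩

/-- Transitivity and irreflexivity suffice, as there are finitely many sets. This direction climbs
to a root; the flipped one drives the recursion of `spawn` to the children. -/
theorem wellFounded_precedes : WellFounded (Precedes F) :=
  have : IsTrans _ (Precedes F) := ⟨fun _ _ _ => Precedes.trans⟩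
  have : Std.Irrefl (Precedes F) := ⟨not_precedes_self⟩
  Finite.wellFounded_of_trans_of_irrefl _

theorem wellFounded_flip_precedes : WellFounded (flip (Precedes F)) :=
  have : IsTrans _ (flip (Precedes F)) := ⟨fun _ _ _ h h' => Precedes.trans h' h⟩
  have : Std.Irrefl (flip (Precedes F)) := ⟨not_precedes_self⟩
  Finite.wellFounded_of_trans_of_irrefl _

end Progress

section Core

variable {S X C : Finset U} {t x v z : U}

theorem IsCore.mem (h : IsCore O S t C v) (hF : IsCommutable F) (hS : S ∈ F)
    (ht : IsSource F S t) : C ∈ F := h.segment.mem hF hS ht.1.2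

theorem IsCore.nonempty (h : IsCore O S t C v) : C.Nonempty := ⟨t, h.segment.start_mem⟩

theorem IsCore.insert_mem (h : IsCore O S t C v) (hF : IsCommutable F) (hS : S ∈ F)
    (ht : IsSource F S t) : insert v C ∈ F :=
  (h.segment.insert_next h.next).mem hF hS ht.1.2

/-- Whatever precedes the next element at some segment up to the core can no longer be added to
the segment after the core. -/
theorem IsCore.not_lt_next (hF : IsCommutable F) (hS : IsMaximalSol F S) (ht : IsSource F S t)
    (h : IsCore O S t C v) (hX : IsSegment F S t X) (hXC : X ⊆ C) (hx : IsNext F S t X x)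
    (hz : z ∈ plus F X Finset.univ) (hz' : z ∈ plus F (insert v C) Finset.univ) :
    ¬ key F X t z < key F X t x := by
  intro hlt
  have hseg := h.segment.insert_next h.next
  by_cases hEq : insert v C = S
  · rw [hEq, hS.plus_eq_empty] at hz'
    simp at hz'
  obtain ⟨x', hx'⟩ := hseg.exists_isNext hEq
  have h₁ := h.follows _ x' hseg subset_rfl hx'
  rw [choose_val_eq_some hF (hseg.mem hF hS.mem ht.1.2) (hseg.isSource ht)] at h₁
  -- The advantage of `z` persists at the later segment, where `choose` nevertheless prefers `x'`.
  exact absurd (hX.key_lt_next hF hS.mem ht.1.2 hseg (hXC.trans (Finset.subset_insert _ _)) hx hx'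
    hz hlt) (not_lt.2 (h₁.key_le hz'))

/-- The element chosen instead of `v` at the core. -/
theorem IsCore.exists_choose (hF : IsCommutable F) (hS : IsMaximalSol F S) (ht : IsSource F S t)
    (h : IsCore O S t C v) : ∃ y, (choose O C Finset.univ).val = some y ∧
      y ∈ plus F C Finset.univ ∧ y ∉ S ∧ key F C t y < key F C t v := by
  obtain ⟨y, hy, hyA⟩ := h.segment.exists_choose (O := O) hF hS.mem ht h.next (Finset.mem_univ v)
  have hyv : y ≠ v := fun hc => h.choose_ne (hc ▸ hy)
  refine ⟨y, hy, hyA.1, h.segment.notMem_of_choose hF hS.mem ht h.next hy hyv, ?_⟩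
  refine (hyA.key_le ?_).lt_of_ne fun hc => hyv (key_injective hc)
  exact mem_plus.2 ⟨Finset.mem_univ _, h.next.1.2, h.insert_mem hF hS.mem ht⟩

theorem mem_complete_of_choose (hF : IsCommutable F) {A : Finset U} (hX : X ∈ F)
    (hx : (choose O X A).val = some x) : x ∈ (complete O X A).val := by
  have hx' := mem_plus.1 (mem_plus_of_choose hF hX hx)
  rw [complete_val, completeLoop_succ_val, hx]
  have hpos : 0 < X.card := by
    rw [Finset.card_pos, Finset.nonempty_iff_ne_empty]
    rintro rfl
    simp [choose_empty] at hx
  exact (completeLoop_spec hF (Fintype.card U) (insert x X) hx'.2.2 (Finset.insert_nonempty _ _)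
    (by rw [Finset.card_insert_of_notMem hx'.2.1]; omega)).2.1 (Finset.mem_insert_self _ _)

/-- The element `y` preferred to `v` at the core is in the parent. If `v` were there too, `y` would
remain addable after `v`, which `IsCore.not_lt_next` excludes. Without this fact `children` would
skip the index `v`. -/
theorem IsCore.notMem_parent (hF : IsCommutable F) (hS : IsMaximalSol F S) (ht : IsSource F S t)
    (h : IsCore O S t C v) : v ∉ (complete O C Finset.univ).val := by
  intro hv
  obtain ⟨y, hy, hyC, hyS, hlt⟩ := h.exists_choose hF hS ht
  have hCF := h.mem hF hS.mem ht
  have hyP := mem_complete_of_choose hF hCF hy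
  refine h.not_lt_next hF hS ht h.segment subset_rfl h.next hyC (mem_plus.2 ⟨Finset.mem_univ _, ?_,
    ?_⟩) hlt
  · exact fun hc => hyS ((h.segment.insert_next h.next).subset hc)
  · exact hF.insert_mem hCF (h.insert_mem hF hS.mem ht) (complete_mem hF hCF h.nonempty) h.nonempty
      (Finset.subset_insert _ _) (Finset.insert_subset hv (subset_complete hF hCF h.nonempty))
      hyP (mem_plus.1 hyC).2.2

/-- If the sources agree, the least key in which the two key sets differ must belong to the parent.
Otherwise it comes from some `x` in `S` not before `v`; then the preferred `y`, of smaller key,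
would occur in `S` as well. -/
theorem IsCore.precedes (hF : IsCommutable F) (hS : IsMaximalSol F S) (ht : IsSource F S t)
    (h : IsCore O S t C v) : Precedes F (complete O C Finset.univ).val S := by
  obtain ⟨y, hy, hyC, hyS, hlt⟩ := h.exists_choose hF hS ht
  have hCF := h.mem hF hS.mem ht
  have hyP := mem_complete_of_choose hF hCF hy
  have hCP := subset_complete (O := O) (A := Finset.univ) hF hCF h.nonempty
  have hPF := complete_mem (O := O) (A := Finset.univ) hF hCF h.nonempty
  set P := (complete O C Finset.univ).val
  have htP := hCP h.segment.start_mem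
  obtain ⟨p, hp⟩ := hF.1.exists_isSource hPF ⟨t, htP⟩
  refine ⟨p, t, hp, ht, ?_⟩
  rcases (hp.2 t htP ht.1.2).lt_or_eq with hpt | rfl
  · exact Or.inl hpt
  refine Or.inr ⟨rfl, ?_⟩
  have hne : (symmDiff (keySet F S p) (keySet F P p)).Nonempty := by
    rw [Finset.nonempty_iff_ne_empty, ← Finset.bot_eq_empty, Ne, symmDiff_eq_bot]
    intro hEq
    have := key_mem_keySet (F := F) (t := p) hyP
    rw [← hEq, mem_keySet] at this
    obtain ⟨x, hx, hxy⟩ := this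
    exact hyS (eq_of_key_eq hxy ▸ hx)
  -- Keys are dualized, so the maximum of the symmetric difference is the smallest key on which the
  -- sets differ, and the colexicographic order is decided there.
  obtain ⟨z, hz, hmax⟩ := Finset.exists_max_image _ id hne
  have hcommon : ∀ a, z < a → (a ∈ keySet F S p ↔ a ∈ keySet F P p) := by
    intro a ha
    by_contra hc
    refine absurd (hmax a ?_) (not_le.2 ha)
    rw [Finset.mem_symmDiff]
    tauto
  rw [Finset.Colex.toColex_lt_toColex_iff_exists_forall_lt]
  rcases Finset.mem_symmDiff.1 hz with ⟨hzS, hzP⟩ | ⟨hzP, hzS⟩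
  swap
  · refine ⟨z, hzP, hzS, fun b hbS hbP => (hmax b ?_).lt_of_ne ?_⟩
    · exact Finset.mem_symmDiff.2 (Or.inl ⟨hbS, hbP⟩)
    · rintro rfl; exact hzS hbS
  exfalso
  obtain ⟨x, hx, rfl⟩ : ∃ x ∈ S, OrderDual.toDual (key F S p x) = z := by
    simpa [keySet] using hzS
  have hltS : ∀ {u}, u ∈ S → key F S p u < key F S p x → ∃ u' ∈ P, key F P p u' = key F S p u :=
    fun {u} hu hlt => mem_keySet.1 ((hcommon _ (OrderDual.toDual_lt_toDual.2 hlt)).1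
      (key_mem_keySet hu))
  have hltP : ∀ {u}, u ∈ P → key F P p u < key F S p x → ∃ u' ∈ S, key F S p u' = key F P p u :=
    fun {u} hu hlt => mem_keySet.1 ((hcommon _ (OrderDual.toDual_lt_toDual.2 hlt)).2
      (key_mem_keySet hu))
  -- Layer sets are read off from the keys, so agreement of all keys below that of `x` gives equal
  -- layer sets below its layer.
  have hlayers : ∀ i < lay F S p x, layerSet F S p i = layerSet F P p i := by
    intro i hi
    ext u
    constructor
    · intro hu
      have huS := layerSet_subset ht.1.1 i hu
      have hul := lay_le_of_mem_layerSet hu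
      obtain ⟨u', hu', hEq⟩ := hltS huS (key_lt_key.2 (Or.inl (by omega)))
      obtain rfl := eq_of_key_eq hEq
      rw [hF.mem_layerSet_iff hPF htP ht.1.2 hu', lay_eq_of_key_eq hEq]
      exact hul
    · intro hu
      have huP := layerSet_subset htP i hu
      have hul := lay_le_of_mem_layerSet hu
      obtain ⟨u', hu', hEq⟩ := hltP huP (key_lt_key.2 (Or.inl (by omega)))
      obtain rfl := eq_of_key_eq hEq
      rw [hF.mem_layerSet_iff hS.mem ht.1.1 ht.1.2 hu', lay_eq_of_key_eq hEq]
      exact hul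
  have hxp : x ≠ p := by
    rintro rfl
    refine hzP (mem_keySet.2 ⟨x, htP, ?_⟩)
    simp [key, lay_start]
  have hpos := hF.lay_pos_of_mem hS.mem ht.1.1 ht.1.2 hx hxp
  have hlay : lay F P p x = lay F S p x :=
    lay_congr (n := lay F S p x - 1) (fun i hi => hlayers i (by omega)) hpos (by omega)
  have hxP : x ∉ P := fun hc => hzP (mem_keySet.2 ⟨x, hc, by simp only [key, hlay]⟩)
  -- Since `x` is outside the parent, it is outside the core, and `v` is the first such element of
  -- `S`.
  have hvx : key F S p v ≤ key F S p x := h.next.2 x hx fun hc => hxP (hCP hc)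
  have hposy := hF.lay_pos_of_mem_plus hCF h.segment.start_mem ht.1.2 hyC
  rw [h.segment.key_next hF hS.mem ht.1.2 h.next] at hlt
  have h₁ : lay F C p y ≤ lay F S p v := by rw [key_lt_key] at hlt; omega
  have h₂ : lay F S p v ≤ lay F S p x := by rw [key_le_key] at hvx; omega
  -- The core, `S` and the parent share the layer sets that determine the layer of `y`, so its key
  -- is the same in the core and in the parent.
  have hylay : lay F P p y = lay F C p y :=
    lay_congr (n := lay F S p v - 1) (fun i hi => by
      rw [h.segment.layerSet_eq h.next (by omega), hlayers i (by omega)]) hposy.1 (by omega)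
  have hykey : key F P p y = key F C p y := by simp only [key, hylay]
  obtain ⟨u, hu, hEq⟩ := hltP hyP (by rw [hykey]; exact hlt.trans_le hvx)
  exact hyS (eq_of_key_eq hEq ▸ hu)

/-- Inside any solution that contains the core and `v`, the canonical order of `S` is followed up
to `v`. -/
theorem IsCore.choose_eq (hF : IsCommutable F) (hS : IsMaximalSol F S) (ht : IsSource F S t)
    (h : IsCore O S t C v) {R : Finset U} (hR : R ∈ F) (hCR : insert v C ⊆ R)
    (hX : IsSegment F S t X) (hXC : X ⊆ C) (hx : IsNext F S t X x) :
    (choose O X R).val = some x := by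
  have hins := h.segment.insert_next h.next
  have hxC : x ∈ insert v C :=
    hins.next_mem hx (hXC.trans_ssubset (Finset.ssubset_insert h.next.1.2))
  obtain ⟨y, hy, hyA⟩ := hX.exists_choose (O := O) hF hS.mem ht hx (hCR hxC)
  by_cases hyx : y = x
  · rw [hy, hyx]
  have hXF := hX.mem hF hS.mem ht.1.2
  have hxmin := hX.isArgmin_of_isNext hF hS.mem ht.1.2 hx
  have hlt : key F X t y < key F X t x :=
    (hyA.key_le (mem_plus.2 ⟨hCR hxC, (mem_plus.1 hxmin.1).2⟩)).lt_of_ne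
      fun hc => hyx (key_injective hc)
  have hy' := mem_plus.1 hyA.1
  have hyS : y ∉ S := fun hc =>
    absurd (hxmin.key_le (mem_plus.2 ⟨hc, hy'.2⟩)) (not_le.2 hlt)
  refine absurd hlt (h.not_lt_next hF hS ht hX hXC hx (mem_plus.2 ⟨Finset.mem_univ _, hy'.2⟩)
    (mem_plus.2 ⟨Finset.mem_univ _, fun hc => hyS (hins.subset hc), ?_⟩))
  -- A rival `y` from `R` stays addable up to `insert v C`, because everything happens inside the
  -- solution `R`.
  exact hF.insert_mem hXF (h.insert_mem hF hS.mem ht) hR ⟨t, hX.start_mem⟩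
    (hXC.trans (Finset.subset_insert _ _)) hCR hy'.1 hy'.2.2

/-- `choose` inside `R` retraces the core and then picks `v`, at which the run halts. It cannot halt
earlier, because `v` is not in the core. -/
theorem IsCore.completeUntil_eq (hF : IsCommutable F) (hS : IsMaximalSol F S)
    (ht : IsSource F S t) (h : IsCore O S t C v) {R : Finset U} (hR : R ∈ F)
    (hCR : insert v C ⊆ R) : (completeUntil O v {t} R).val = C := by
  have key : ∀ n X, IsSegment F S t X → X ⊆ C → Fintype.card U < n + X.card →
      (completeLoop O R (some v) n X).val = C := by
    intro n
    induction n with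
    | zero =>
      intro X _ _ hn
      have := Finset.card_le_univ X
      omega
    | succ n ih =>
      intro X hX hXC hn
      rw [completeLoop_succ_val]
      by_cases hEq : X = C
      · subst hEq
        simp [h.choose_eq hF hS ht hR hCR hX hXC h.next]
      · obtain ⟨x, hx⟩ := hX.exists_isNext fun hc =>
          h.next.1.2 (hXC (hc ▸ h.next.1.1))
        have hxC := h.segment.next_mem hx (hXC.ssubset_of_ne hEq)
        have hvx : v ≠ x := by rintro rfl; exact h.next.1.2 hxC
        simp only [h.choose_eq hF hS ht hR hCR hX hXC hx, Option.some_inj, hvx, if_false]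
        refine ih (insert x X) (hX.insert_next hx) (Finset.insert_subset hxC hXC) ?_
        rw [Finset.card_insert_of_notMem hx.1.2]
        omega
  exact key _ _ (isSegment_singleton hF hS.mem ht.1.1 ht.1.2) (by simpa using h.segment.start_mem)
    (by omega)

end Core

end Parent

/-! ### Outputs of records -/

section Outputs

variable {U α : Type u}

theorem outputs_append (l₁ l₂ : Log U) : outputs (l₁ ++ l₂) = outputs l₁ ++ outputs l₂ := by
  induction l₁ with
  | nil => rfl
  | cons e l ih => cases e <;> simp [outputs, ih]

@[simp] theorem outputs_nil : outputs ([] : Log U) = [] := rfl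

@[simp] theorem outputs_work (k : ℕ) (l : Log U) : outputs (Event.work k :: l) = outputs l := rfl

@[simp] theorem outputs_emit (S : Finset U) (l : Log U) :
    outputs (Event.emit S :: l) = S :: outputs l := rfl

@[simp] theorem outputs_andThen (x : Timed α) (k : α → Log U) :
    outputs (x.andThen k) = outputs (k x.val) := rfl

theorem outputs_forLog (l : List α) (body : α → Log U) :
    outputs (forLog l body) = l.flatMap fun a => outputs (body a) := by
  induction l with
  | nil => rfl
  | cons a l ih =>
    have : forLog (a :: l) body = Event.work 1 :: body a ++ forLog l body := by simp [forLog]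
    rw [this, outputs_append, ih]
    simp

theorem nodup_flatMap_of_unique {α β : Type*} {l : List α} {f : α → List β} (hl : l.Nodup)
    (hf : ∀ a ∈ l, (f a).Nodup)
    (h : ∀ a ∈ l, ∀ b ∈ l, ∀ z, z ∈ f a → z ∈ f b → a = b) : (l.flatMap f).Nodup := by
  rw [List.nodup_flatMap]
  refine ⟨hf, hl.imp_of_mem fun {a b} ha hb hab => ?_⟩
  exact fun z hza hzb => hab (h a ha b hb z hza hzb)

end Outputs

/-! ### What `children` and `roots` yield -/

section Generators

variable {U : Type u} [Fintype U] [LinearOrder U] {F : Finset (Finset U)} {O : BlackBox F}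

theorem isStart_val (R : Finset U) (w s : U) :
    (isStart O R w s).val.down = decide (s ∈ R ∧ s ≠ w ∧ {s} ∈ F) := by
  by_cases h : s ∈ R
  · by_cases h' : s = w
    · subst h'
      simp [isStart, h]
    · simp [isStart, h, h']
  · simp [isStart, h]

theorem candidate_val (P : Finset U) (w : U) (R : Finset U) (s : U) :
    (candidate O P w R s).val =
      match (corePi O (complete O (insert w (completeUntil O w {s} R).val) Finset.univ).val).val with
      | none => none
      | some (C, v) =>
        if (complete O C Finset.univ).val = P ∧ v = w ∧
          (complete O (insert v C) (insert v (complete O C Finset.univ).val)).val = R ∧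
          (source O (complete O (insert w (completeUntil O w {s} R).val) Finset.univ).val).val =
            some s
        then some (complete O (insert w (completeUntil O w {s} R).val) Finset.univ).val
        else none := by
  simp only [candidate, Timed.val_bind, fullSet_val, emptySet_val, insertElt_val, insert_empty_eq]
  cases (corePi O (complete O (insert w (completeUntil O w {s} R).val) Finset.univ).val).val with
  | none => rfl
  | some cp =>
    obtain ⟨C, v⟩ := cp
    simp only [Timed.val_bind, Timed.val_after, copySet_val, insertElt_val, sameSet_val,
      sameElt_val, decide_eq_true_eq]
    split_ifs <;> rfl

/-- `P` is the parent of the maximal solution `S`, and `w` is its parent index. -/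
def IsChildAt (O : BlackBox F) (P : Finset U) (w : U) (S : Finset U) : Prop :=
  IsMaximalSol F S ∧ ∃ C, (corePi O S).val = some (C, w) ∧ (complete O C Finset.univ).val = P

theorem IsMaximalSol.nonempty_of_corePi {S : Finset U} {r : Finset U × U}
    (h : (corePi O S).val = some r) : S.Nonempty := by
  rw [Finset.nonempty_iff_ne_empty]
  rintro rfl
  rw [corePi_val_eq_none_of_source source_val_empty] at h
  cases h

/-- Avoiding `w`, the set `R` would lie inside the solution `P`, hence equal it by maximality. -/
theorem mem_of_isMaximalIn_insert {P R : Finset U} {w : U}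
    (hP : IsMaximalSol F P) (hR : IsMaximalIn F (insert w P) R) (hRP : R ≠ P) : w ∈ R := by
  by_contra hw
  have : R ⊆ P := fun x hx => (Finset.mem_insert.1 (hR.2.1 hx)).resolve_left
    (by rintro rfl; exact hw hx)
  exact hRP (hR.2.2 P hP.mem (Finset.subset_insert _ _) this).symm

theorem candidate_isMaximalSol (hF : IsCommutable F) {w s : U} {R : Finset U} (hR : R ∈ F)
    (hw : w ∈ R) (hs : s ∈ R) (hsF : {s} ∈ F) :
    IsMaximalSol F (complete O (insert w (completeUntil O w {s} R).val) Finset.univ).val :=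
  isMaximalSol_complete hF (insert_completeUntil_mem hF hsF (Finset.singleton_nonempty s)
    (by simpa using hs) hR hw) (Finset.insert_nonempty _ _)

/-- The test guards one direction. For the other, the prescribed data force the truncated completion
to stop exactly at the core, and the full completion then returns `S`. -/
theorem candidate_val_eq_some (hF : IsCommutable F) {P R S : Finset U} {w s : U}
    (hR : R ∈ F) (hw : w ∈ R) (hs : s ∈ R) (hsF : {s} ∈ F) :
    (candidate O P w R s).val = some S ↔ IsMaximalSol F S ∧ IsSource F S s ∧
      ∃ C, (corePi O S).val = some (C, w) ∧ (complete O C Finset.univ).val = P ∧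
        (complete O (insert w C) (insert w P)).val = R := by
  have hmax := candidate_isMaximalSol (O := O) hF hR hw hs hsF
  rw [candidate_val]
  constructor
  · intro h
    cases hcp : (corePi O (complete O (insert w (completeUntil O w {s} R).val)
        Finset.univ).val).val with
    | none => simp [hcp] at h
    | some cp =>
      obtain ⟨C, v⟩ := cp
      rw [hcp] at h
      dsimp only at h
      split_ifs at h with hc
      obtain ⟨rfl, rfl, h₃, h₄⟩ := hc
      obtain rfl := Option.some_injective _ h
      exact ⟨hmax, source_val_eq_some.1 h₄, C, hcp, rfl, h₃⟩
  · rintro ⟨hS, hsrc, C, hC, rfl, rfl⟩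
    have hcore := (corePi_val_eq_some hF hS.mem hsrc).1 hC
    have hins := hcore.insert_mem hF hS.mem hsrc
    have hsub : insert w C ⊆ (complete O (insert w C)
      (insert w (complete O C Finset.univ).val)).val :=
        subset_complete hF hins (Finset.insert_nonempty _ _)
    have hSeq : (complete O (insert w C) Finset.univ).val = S :=
      (complete_eq_iff hF hS hsrc (hcore.segment.insert_next hcore.next)).2 hcore.follows
    rw [hcore.completeUntil_eq hF hS hsrc hR hsub, hSeq, hC]
    dsimp only
    rw [if_pos ⟨rfl, rfl, rfl, source_val_eq_some.2 hsrc⟩]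

theorem mem_outputs_match {r : Option (Finset U)} {S : Finset U} :
    S ∈ outputs (match r with | none => [] | some S => [Event.emit S] : Log U) ↔ r = some S := by
  cases r with
  | none => simp
  | some S' => simp [eq_comm]

theorem mem_outputs_children_iff {P S : Finset U} {w : U} :
    S ∈ outputs (children O P w) ↔ w ∉ P ∧ ∃ R ∈ O.restr P w, R ≠ P ∧
      ∃ s, (s ∈ R ∧ s ≠ w ∧ {s} ∈ F) ∧ (candidate O P w R s).val = some S := by
  rw [children, outputs_andThen]
  by_cases hw : w ∈ P
  · simp [hw]
  · simp only [contains_val, hw, decide_false, Bool.false_eq_true, if_false, outputs_andThen,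
      outputs_forLog, List.mem_flatMap, solveRestr_val, not_false_eq_true, true_and]
    refine exists_congr fun R => and_congr_right fun _ => ?_
    by_cases hRP : R = P
    · simp [hRP]
    · simp only [sameSet_val, hRP, decide_false, Bool.false_eq_true, if_false, outputs_forLog,
        List.mem_flatMap, mem_elems, true_and, outputs_andThen, isStart_val, ne_eq,
        not_false_eq_true]
      refine exists_congr fun s => ?_
      by_cases hs : s ∈ R ∧ ¬s = w ∧ {s} ∈ F
      · simp only [hs, decide_true, if_true, outputs_andThen, true_and, not_false_eq_true, and_self]
        exact mem_outputs_match
      · simp [hs]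

/-- A child arises from `R` = r(S) and `s` = source(S). This `R` is maximal in `insert w P`, and
differs from `P` because it contains `w`; thus the black box lists it. -/
theorem mem_outputs_children (hF : IsCommutable F) {P S : Finset U} {w : U}
    (hP : IsMaximalSol F P) : S ∈ outputs (children O P w) ↔ IsChildAt O P w S := by
  rw [mem_outputs_children_iff]
  constructor
  · rintro ⟨hw, R, hR, hRP, s, ⟨hs, -, hsF⟩, hc⟩
    rw [O.mem_restr P hP w hw R hRP] at hR
    rw [candidate_val_eq_some hF hR.1 (mem_of_isMaximalIn_insert hP hR hRP) hs hsF] at hc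
    obtain ⟨hS, -, C, hC, hCP, -⟩ := hc
    exact ⟨hS, C, hC, hCP⟩
  · rintro ⟨hS, C, hC, rfl⟩
    obtain ⟨t, ht⟩ := hF.1.exists_isSource hS.mem (IsMaximalSol.nonempty_of_corePi hC)
    have hcore := (corePi_val_eq_some hF hS.mem ht).1 hC
    have hCF := hcore.mem hF hS.mem ht
    have hw := hcore.notMem_parent hF hS ht
    have hins := hcore.insert_mem hF hS.mem ht
    have hmax := isMaximalIn_complete (O := O) (A := insert w (complete O C Finset.univ).val) hF
      hins (Finset.insert_nonempty _ _)
      (Finset.insert_subset_insert _ (subset_complete hF hCF hcore.nonempty))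
    have hsub : insert w C ⊆ (complete O (insert w C)
      (insert w (complete O C Finset.univ).val)).val :=
        subset_complete hF hins (Finset.insert_nonempty _ _)
    set R := (complete O (insert w C) (insert w (complete O C Finset.univ).val)).val with hRdef
    have hwR : w ∈ R := hsub (Finset.mem_insert_self _ _)
    have hRP : R ≠ (complete O C Finset.univ).val := fun hc => hw (hc ▸ hwR)
    have htR : t ∈ R := hsub (Finset.mem_insert_of_mem hcore.segment.start_mem)
    refine ⟨hw, R, (O.mem_restr _ hP w hw R hRP).2 hmax, hRP, t, ⟨htR, ?_, ht.1.2⟩, ?_⟩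
    · rintro rfl
      exact hcore.next.1.2 hcore.segment.start_mem
    · rw [candidate_val_eq_some hF hmax.1 hwR htR ht.1.2]
      exact ⟨hS, ht, C, hC, rfl, rfl⟩

/-- The test makes `R` and `s` functions of the yielded `S`, so no two iterations of the nested
loops can agree, provided `R` itself is listed once. -/
theorem nodup_outputs_children (hF : IsCommutable F) {P : Finset U} {w : U}
    (hP : IsMaximalSol F P) : (outputs (children O P w)).Nodup := by
  rw [children, outputs_andThen]
  by_cases hw : w ∈ P
  · simp [hw]
  simp only [contains_val, hw, decide_false, Bool.false_eq_true, if_false, outputs_andThen,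
    outputs_forLog, solveRestr_val]
  have key : ∀ R ∈ O.restr P w, ∀ S, S ∈ outputs (if (sameSet R P).val.down then [] else
      forLog (elems U) fun s => (isStart O R w s).andThen fun ok =>
        if ok.down then (candidate O P w R s).andThen fun res =>
          match res with
          | none => []
          | some S => [Event.emit S]
        else [] : Log U) → IsMaximalSol F S ∧ ∃ C, (corePi O S).val = some (C, w) ∧
          (complete O (insert w C) (insert w P)).val = R := by
    intro R hR S hS
    by_cases hRP : R = P
    · simp [hRP] at hS
    · simp only [sameSet_val, hRP, decide_false, Bool.false_eq_true, if_false, outputs_forLog,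
        List.mem_flatMap, mem_elems, true_and, outputs_andThen, isStart_val, ne_eq] at hS
      obtain ⟨s, hS⟩ := hS
      by_cases hs : s ∈ R ∧ ¬s = w ∧ {s} ∈ F
      · rw [if_pos (decide_eq_true hs), outputs_andThen] at hS
        have hc := mem_outputs_match.1 hS
        rw [O.mem_restr P hP w hw R hRP] at hR
        rw [candidate_val_eq_some hF hR.1 (mem_of_isMaximalIn_insert hP hR hRP) hs.1 hs.2.2] at hc
        exact ⟨hc.1, hc.2.2.imp fun C h => ⟨h.1, h.2.2⟩⟩
      · simp [hs] at hS
  refine nodup_flatMap_of_unique (O.restr_nodup P hP w hw) (fun R hR => ?_) ?_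
  · by_cases hRP : R = P
    · simp [hRP]
    rw [O.mem_restr P hP w hw R hRP] at hR
    have hwR := mem_of_isMaximalIn_insert hP hR hRP
    simp only [sameSet_val, hRP, decide_false, Bool.false_eq_true, if_false, outputs_forLog,
      outputs_andThen, isStart_val, ne_eq]
    refine nodup_flatMap_of_unique elems_nodup (fun s _ => ?_) ?_
    · by_cases hs : s ∈ R ∧ ¬s = w ∧ {s} ∈ F
      · rw [if_pos (decide_eq_true hs), outputs_andThen]
        cases (candidate O P w R s).val <;> simp
      · simp [hs]
    · have hsrc : ∀ s S, S ∈ outputs (if decide (s ∈ R ∧ ¬s = w ∧ {s} ∈ F) then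
          (candidate O P w R s).andThen fun res =>
            match res with
            | none => []
            | some S => [Event.emit S]
          else [] : Log U) → IsSource F S s := by
        intro s S hS
        by_cases hs : s ∈ R ∧ ¬s = w ∧ {s} ∈ F
        · rw [if_pos (decide_eq_true hs), outputs_andThen] at hS
          have hc := mem_outputs_match.1 hS
          rw [candidate_val_eq_some hF hR.1 hwR hs.1 hs.2.2] at hc
          exact hc.2.1
        · simp [hs] at hS
      intro s _ s' _ S hS hS'
      exact (hsrc s S hS).unique (hsrc s' S hS')
  · intro R hR R' hR' S hS hS'
    obtain ⟨-, C, hC, hCR⟩ := key R hR S hS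
    obtain ⟨-, C', hC', hCR'⟩ := key R' hR' S hS'
    rw [hC] at hC'
    simp only [Option.some_inj, Prod.mk.injEq, and_true] at hC'
    rw [← hCR, ← hCR', hC']

/-- The record of the loop over `U` in `spawn`. -/
def childrenLog (O : BlackBox F) (P : Finset U) : Log U :=
  forLog (elems U) fun w => children O P w

/-- `P` is the parent of the maximal solution `S`. -/
def IsChild (O : BlackBox F) (P S : Finset U) : Prop := ∃ w, IsChildAt O P w S

theorem mem_outputs_childrenLog (hF : IsCommutable F) {P S : Finset U} (hP : IsMaximalSol F P) :
    S ∈ outputs (childrenLog O P) ↔ IsChild O P S := by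
  simp [childrenLog, outputs_forLog, mem_outputs_children hF hP, IsChild]

theorem nodup_outputs_childrenLog (hF : IsCommutable F) {P : Finset U} (hP : IsMaximalSol F P) :
    (outputs (childrenLog O P)).Nodup := by
  rw [childrenLog, outputs_forLog]
  refine nodup_flatMap_of_unique elems_nodup (fun w _ => nodup_outputs_children hF hP) ?_
  intro w _ w' _ S hS hS'
  rw [mem_outputs_children hF hP] at hS hS'
  obtain ⟨-, C, hC, -⟩ := hS
  obtain ⟨-, C', hC', -⟩ := hS'
  rw [hC] at hC'
  simp only [Option.some_inj, Prod.mk.injEq] at hC'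
  exact hC'.2

theorem IsChild.unique {P P' S : Finset U} (h : IsChild O P S) (h' : IsChild O P' S) : P = P' := by
  obtain ⟨w, -, C, hC, rfl⟩ := h
  obtain ⟨w', -, C', hC', rfl⟩ := h'
  rw [hC] at hC'
  simp only [Option.some_inj, Prod.mk.injEq] at hC'
  rw [hC'.1]

theorem IsChild.precedes (hF : IsCommutable F) {P S : Finset U} (h : IsChild O P S) :
    Precedes F P S := by
  obtain ⟨w, hS, C, hC, rfl⟩ := h
  obtain ⟨t, ht⟩ := hF.1.exists_isSource hS.mem (IsMaximalSol.nonempty_of_corePi hC)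
  exact ((corePi_val_eq_some hF hS.mem ht).1 hC).precedes hF hS ht

theorem IsChild.isMaximalSol {P S : Finset U} (h : IsChild O P S) : IsMaximalSol F S :=
  h.choose_spec.1

theorem IsChild.isMaximalSol_parent (hF : IsCommutable F) {P S : Finset U} (h : IsChild O P S) :
    IsMaximalSol F P := by
  obtain ⟨w, hS, C, hC, rfl⟩ := h
  obtain ⟨t, ht⟩ := hF.1.exists_isSource hS.mem (IsMaximalSol.nonempty_of_corePi hC)
  have hcore := (corePi_val_eq_some hF hS.mem ht).1 hC
  exact isMaximalSol_complete hF (hcore.mem hF hS.mem ht) hcore.nonempty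

/-- The body of the loop of `roots`. -/
def rootCandidate (O : BlackBox F) (s : U) : Timed (Finset U × Option U) := do
  let V ← fullSet
  let E ← emptySet
  let X ← insertElt s E
  let S ← complete O X V
  let t ← source O S
  pure (S, t)

theorem rootCandidate_val (s : U) : (rootCandidate O s).val =
    ((complete O {s} Finset.univ).val, (source O (complete O {s} Finset.univ).val).val) := by
  simp [rootCandidate]

theorem roots_eq (O : BlackBox F) : roots O =
    (findFirst (isGood O) (elems U)).andThen fun z =>
      match z with
      | none => [Event.emit ∅]
      | some _ => forLog (elems U) fun s => (isGood O s).andThen fun ok =>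
        if ok.down then (rootCandidate O s).andThen fun r =>
          Event.work 1 :: if r.2 = some s then [Event.emit r.1] else []
        else [] := rfl

theorem outputs_rootBody (s : U) :
    outputs ((isGood O s).andThen fun ok =>
        if ok.down then (rootCandidate O s).andThen fun r =>
          Event.work 1 :: if r.2 = some s then [Event.emit r.1] else []
        else []) =
      if {s} ∈ F ∧ (source O (complete O {s} Finset.univ).val).val = some s then
        [(complete O {s} Finset.univ).val] else [] := by
  rw [outputs_andThen, isGood_val]
  by_cases h : {s} ∈ F
  · simp only [h, decide_true, if_true, outputs_andThen, rootCandidate_val, outputs_work, true_and]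
    split_ifs <;> rfl
  · simp [h]

/-- Every nonempty solution has a source. So either no singleton is a solution and only `∅` exists,
or the roots are the completions of their own sources, which means no deviation at all. -/
theorem mem_outputs_roots (hF : IsCommutable F) {S : Finset U} :
    S ∈ outputs (roots O) ↔ IsMaximalSol F S ∧ (corePi O S).val = none := by
  rw [roots_eq, outputs_andThen, findFirst_val]
  simp only [isGood_val]
  cases hz : (elems U).find? fun a => decide ({a} ∈ F) with
  | none =>
    have hz' : ∀ a : U, {a} ∉ F := fun a => by
      simpa using List.find?_eq_none.1 hz a (mem_elems a)
    have hempty : ∀ X ∈ F, X = ∅ := fun X hX => by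
      by_contra hne
      obtain ⟨t, ht⟩ := hF.1.exists_isSource hX (Finset.nonempty_iff_ne_empty.2 hne)
      exact hz' t ht.1.2
    simp only [outputs_emit, outputs_nil, List.mem_singleton]
    constructor
    · rintro rfl
      exact ⟨⟨hF.1.1, Finset.subset_univ _, fun Y hY _ _ => hempty Y hY⟩,
        corePi_val_eq_none_of_source source_val_empty⟩
    · exact fun h => hempty S h.1.mem
  | some z =>
    have hz' : {z} ∈ F := by simpa using List.find?_some hz
    simp only [outputs_forLog, List.mem_flatMap, mem_elems, true_and]
    constructor
    · rintro ⟨s, hs⟩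
      rw [outputs_rootBody] at hs
      split_ifs at hs with hc
      · obtain ⟨hsF, hsrc⟩ := hc
        rw [source_val_eq_some] at hsrc
        obtain rfl := List.mem_singleton.1 hs
        have hmax := isMaximalSol_complete (O := O) hF hsF (Finset.singleton_nonempty s)
        refine ⟨hmax, ?_⟩
        rw [corePi_val_eq_none hF hmax.mem hsrc, ← complete_eq_iff hF hmax hsrc
          (isSegment_singleton hF hmax.mem hsrc.1.1 hsF)]
      · simp at hs
    · rintro ⟨hS, hnone⟩
      have hne : S.Nonempty := by
        rw [Finset.nonempty_iff_ne_empty]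
        rintro rfl
        exact absurd (hS.2.2 _ hz' (Finset.subset_univ _) (Finset.empty_subset _)) (by simp)
      obtain ⟨t, ht⟩ := hF.1.exists_isSource hS.mem hne
      rw [corePi_val_eq_none hF hS.mem ht, ← complete_eq_iff hF hS ht
        (isSegment_singleton hF hS.mem ht.1.1 ht.1.2)] at hnone
      refine ⟨t, ?_⟩
      rw [outputs_rootBody, hnone, if_pos ⟨ht.1.2, source_val_eq_some.2 ht⟩]
      exact List.mem_singleton.2 rfl

theorem nodup_outputs_roots : (outputs (roots O)).Nodup := by
  rw [roots_eq, outputs_andThen]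
  cases (findFirst (isGood O) (elems U)).val with
  | none => simp
  | some z =>
    simp only [outputs_forLog]
    refine nodup_flatMap_of_unique elems_nodup (fun s _ => ?_) ?_
    · rw [outputs_rootBody]
      split_ifs <;> simp
    · intro s _ s' _ S hS hS'
      rw [outputs_rootBody] at hS hS'
      split_ifs at hS hS' with h h'
      · simp only [List.mem_singleton] at hS hS'
        rw [← hS, source_val_eq_some] at h
        rw [← hS', source_val_eq_some] at h'
        exact h.2.unique h'.2
      all_goals simp at hS hS'

theorem exists_isChild_of_not_root {S : Finset U} (hS : IsMaximalSol F S)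
    (h : (corePi O S).val ≠ none) : ∃ P, IsChild O P S := by
  obtain ⟨⟨C, v⟩, hC⟩ := Option.ne_none_iff_exists'.1 h
  exact ⟨_, v, hS, C, hC, rfl⟩

theorem IsChild.corePi_ne_none {P S : Finset U} (h : IsChild O P S) :
    (corePi O S).val ≠ none := by
  obtain ⟨w, -, C, hC, -⟩ := h
  simp [hC]

end Generators

/-! ### Substituting records of recursive calls, and their delay -/

section Logs

variable {U : Type u}

/-- The number of steps in a record. -/
def totalWork : Log U → ℕ
  | [] => 0
  | .work k :: l => k + totalWork l
  | .emit _ :: l => totalWork l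

theorem totalWork_append (l₁ l₂ : Log U) :
    totalWork (l₁ ++ l₂) = totalWork l₁ + totalWork l₂ := by
  induction l₁ with
  | nil => simp [totalWork]
  | cons e l ih => cases e <;> simp [totalWork, ih, add_assoc]

theorem delayFrom_mono {l : Log U} : ∀ {a b : ℕ}, a ≤ b → delayFrom a l ≤ delayFrom b l := by
  induction l with
  | nil => exact fun h => h
  | cons e l ih =>
    intro a b h
    cases e with
    | work k => exact ih (by omega)
    | emit S => exact max_le_max h le_rfl

/-- Replace every emission of `S` in a record by the record `g S`. -/
def substLog (g : Finset U → Log U) : Log U → Log U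
  | [] => []
  | .work c :: l => .work c :: substLog g l
  | .emit S :: l => g S ++ substLog g l

theorem expand_eq_some {k : Finset U → Option (Log U)} {g : Finset U → Log U} {l : Log U}
    (h : ∀ S ∈ outputs l, k S = some (g S)) : expand k l = some (substLog g l) := by
  induction l with
  | nil => rfl
  | cons e l ih =>
    cases e with
    | work c => simp [expand, substLog, ih h]
    | emit S =>
      simp only [outputs_emit, List.mem_cons, forall_eq_or_imp] at h
      simp [expand, substLog, ih h.2, h.1]

theorem outputs_substLog (g : Finset U → Log U) (l : Log U) :
    outputs (substLog g l) = (outputs l).flatMap fun S => outputs (g S) := by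
  induction l with
  | nil => rfl
  | cons e l ih => cases e <;> simp [substLog, outputs_append, ih]

/-- The delay stays within `D` through the record `a`, if at most `D - h` steps have been spent
since the last output when it starts; what follows sees at most `t` steps since the last output. -/
def DelayBound (h t D : ℕ) (a : Log U) : Prop :=
  ∀ acc rest, acc + h ≤ D → delayFrom t rest ≤ D → delayFrom acc (a ++ rest) ≤ D

/-- In the worst case all own work `W` falls into one gap. Such a gap begins with `acc` steps before
the first nested record or with `t` steps after some nested record, and may be prolonged by the `h`
steps at the start of the next one. -/
theorem delayFrom_substLog_le {g : Finset U → Log U} {h t D : ℕ} :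
    ∀ {l : Log U} {W : ℕ} {acc : ℕ} {rest : Log U}, totalWork l ≤ W →
      (∀ S ∈ outputs l, DelayBound h t D (g S)) → acc + W + h ≤ D → t + W + h ≤ D →
      delayFrom (max acc t + W) rest ≤ D → delayFrom acc (substLog g l ++ rest) ≤ D := by
  intro l
  induction l with
  | nil =>
    intro W acc rest _ _ _ _ h₃
    exact (delayFrom_mono (by omega)).trans h₃
  | cons e l ih =>
    intro W acc rest hW hg h₁ h₂ h₃
    cases e with
    | work c =>
      simp only [totalWork] at hW
      refine ih (W := W - c) (acc := acc + c) (by omega) hg (by omega) (by omega) ?_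
      exact (delayFrom_mono (by omega)).trans h₃
    | emit S =>
      simp only [outputs_emit, List.mem_cons, forall_eq_or_imp] at hg
      simp only [substLog, List.append_assoc]
      -- After the nested record the count restarts at `t` or less, so the induction hypothesis
      -- applies with `t` in place of `acc`.
      refine hg.1 acc _ (by omega) (ih (W := W) hW hg.2 h₂ h₂ ?_)
      exact (delayFrom_mono (by omega)).trans h₃

end Logs

/-! ### The forest of parents, termination and delay -/

section Termination

variable {U : Type u} [Fintype U] [LinearOrder U] {F : Finset (Finset U)} {O : BlackBox F}

/-- `P` is reached from `S` by passing to parents. -/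
def IsAncestor (O : BlackBox F) (S P : Finset U) : Prop :=
  Relation.ReflTransGen (fun S P => IsChild O P S) S P

theorem IsAncestor.eq_or_precedes (hF : IsCommutable F) {S P : Finset U} (h : IsAncestor O S P) :
    S = P ∨ Precedes F P S := by
  induction h with
  | refl => exact Or.inl rfl
  | tail _ h ih =>
    right
    rcases ih with rfl | ih
    · exact h.precedes hF
    · exact (h.precedes hF).trans ih

theorem IsAncestor.not_isChild (hF : IsCommutable F) {S P : Finset U} (h : IsAncestor O P S) :
    ¬ IsChild O P S := by
  intro hc
  rcases h.eq_or_precedes hF with rfl | h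
  · exact not_precedes_self _ (hc.precedes hF)
  · exact not_precedes_self _ ((hc.precedes hF).trans h)

theorem IsAncestor.total {S P P' : Finset U} (h : IsAncestor O S P) (h' : IsAncestor O S P') :
    IsAncestor O P P' ∨ IsAncestor O P' P :=
  Relation.ReflTransGen.total_of_right_unique (fun _ _ _ h h' => IsChild.unique h h') h h'

/-- The ancestors of `X` form a chain. If one of two distinct children of `P` were an ancestor of
the other, it would be an ancestor of `P` too, contradicting progress. So the subtrees of different
children are disjoint. -/
theorem IsAncestor.eq_of_isChild (hF : IsCommutable F) {P S S' X : Finset U} (h : IsChild O P S)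
    (h' : IsChild O P S') (hX : IsAncestor O X S) (hX' : IsAncestor O X S') : S = S' := by
  have key : ∀ {S S'}, IsChild O P S → IsChild O P S' → IsAncestor O S S' → S = S' := by
    intro S S' h h' hs
    rcases Relation.ReflTransGen.cases_head hs with hEq | ⟨c, hc, hs⟩
    · exact hEq
    · obtain rfl := hc.unique h
      exact absurd h' (IsAncestor.not_isChild hF hs)
  rcases hX.total hX' with hs | hs
  · exact key h h' hs
  · exact (key h' h hs).symm

theorem IsAncestor.eq_of_root {R R' X : Finset U} (h : (corePi O R).val = none)
    (h' : (corePi O R').val = none) (hX : IsAncestor O X R) (hX' : IsAncestor O X R') :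
    R = R' := by
  have key : ∀ {S S'}, (corePi O S).val = none → IsAncestor O S S' → S = S' := by
    intro S S' h hs
    rcases Relation.ReflTransGen.cases_head hs with hEq | ⟨c, hc, -⟩
    · exact hEq
    · exact absurd h hc.corePi_ne_none
  rcases hX.total hX' with hs | hs
  · exact key h hs
  · exact (key h' hs).symm

theorem isAncestor_iff {S P : Finset U} :
    IsAncestor O S P ↔ S = P ∨ ∃ S', IsChild O P S' ∧ IsAncestor O S S' := by
  rw [IsAncestor, Relation.ReflTransGen.cases_tail_iff, eq_comm]
  refine or_congr_right (exists_congr fun c => and_comm)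

theorem exists_root (hF : IsCommutable F) {S : Finset U} (hS : IsMaximalSol F S) :
    ∃ R, IsMaximalSol F R ∧ (corePi O R).val = none ∧ IsAncestor O S R := by
  induction S using (wellFounded_precedes (F := F)).induction with
  | h S ih =>
    by_cases h : (corePi O S).val = none
    · exact ⟨S, hS, h, .refl⟩
    · obtain ⟨P, hP⟩ := exists_isChild_of_not_root hS h
      obtain ⟨R, h₁, h₂, h₃⟩ := ih P (hP.precedes hF) (hP.isMaximalSol_parent hF)
      exact ⟨R, h₁, h₂, .head hP h₃⟩

theorem IsAncestor.isMaximalSol {S P : Finset U} (hP : IsMaximalSol F P) (h : IsAncestor O S P) :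
    IsMaximalSol F S := by
  rcases Relation.ReflTransGen.cases_head h with rfl | ⟨c, hc, -⟩
  · exact hP
  · exact hc.isMaximalSol

theorem spawn_succ (n d : ℕ) (X : Finset U) {g : Finset U → Log U}
    (hg : ∀ S ∈ outputs (childrenLog O X), spawn O n (d + 1) S = some (g S)) :
    spawn O (n + 1) d X = some
      ((Event.work 1 :: if Odd d then outputSet X else []) ++ substLog g (childrenLog O X) ++
        if Even d then outputSet X else []) := by
  have := expand_eq_some hg
  rw [childrenLog] at this
  rw [spawn, this]
  rfl

/-- The induction goes to children, which are larger for `Precedes`. A call at even depth may take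
`2 + W + |U|` steps before its first output but ends with an output; one at odd depth starts with
its output but may leave `W` steps after its last one. -/
theorem spawn_spec (hF : IsCommutable F) {W D : ℕ}
    (hW : ∀ P, IsMaximalSol F P → totalWork (childrenLog O P) ≤ W)
    (hD : 2 * W + 2 + Fintype.card U ≤ D) {P : Finset U} (hP : IsMaximalSol F P) (d : ℕ) :
    ∃ (L : Log U) (N : ℕ), (∀ n ≥ N, spawn O n d P = some L) ∧
      (∀ S, S ∈ outputs L ↔ IsAncestor O S P) ∧ (outputs L).Nodup ∧
      DelayBound (if Even d then 2 + W + Fintype.card U else 1 + Fintype.card U)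
        (if Even d then 0 else W) D L := by
  induction P using (wellFounded_flip_precedes (F := F)).induction generalizing d with
  | h P ih =>
    -- Sets that are not children receive a dummy record, so that a record can be chosen for all
    -- sets at once.
    have hex : ∀ S, ∃ (L : Log U) (N : ℕ), IsChild O P S →
        (∀ n ≥ N, spawn O n (d + 1) S = some L) ∧
        (∀ X, X ∈ outputs L ↔ IsAncestor O X S) ∧ (outputs L).Nodup ∧
        DelayBound (if Even (d + 1) then 2 + W + Fintype.card U else 1 + Fintype.card U)
          (if Even (d + 1) then 0 else W) D L := by
      intro S
      by_cases hS : IsChild O P S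
      · obtain ⟨L, N, h⟩ := ih S (hS.precedes hF) hS.isMaximalSol (d + 1)
        exact ⟨L, N, fun _ => h⟩
      · exact ⟨[], 0, fun h => absurd h hS⟩
    choose g N hg using hex
    have hout : ∀ S, S ∈ outputs (childrenLog O P) ↔ IsChild O P S :=
      fun S => mem_outputs_childrenLog hF hP
    have hbody_mem : ∀ X, X ∈ outputs (substLog g (childrenLog O P)) ↔
        ∃ S, IsChild O P S ∧ IsAncestor O X S := by
      intro X
      rw [outputs_substLog, List.mem_flatMap]
      refine exists_congr fun S => ?_
      rw [hout]
      exact and_congr_right fun hS => (hg S hS).2.1 X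
    have hbody_nodup : (outputs (substLog g (childrenLog O P))).Nodup := by
      rw [outputs_substLog]
      refine nodup_flatMap_of_unique (nodup_outputs_childrenLog hF hP)
        (fun S hS => (hg S ((hout S).1 hS)).2.2.1) ?_
      intro S hS S' hS' X hX hX'
      rw [hout] at hS hS'
      exact IsAncestor.eq_of_isChild hF hS hS' (((hg S hS).2.1 X).1 hX) (((hg S' hS').2.1 X).1 hX')
    have hP_notMem : P ∉ outputs (substLog g (childrenLog O P)) := by
      rw [hbody_mem]
      rintro ⟨S, hS, hPS⟩
      exact hPS.not_isChild hF hS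
    have hbound : ∀ S ∈ outputs (childrenLog O P), DelayBound
        (if Even (d + 1) then 2 + W + Fintype.card U else 1 + Fintype.card U)
        (if Even (d + 1) then 0 else W) D (g S) := fun S hS => (hg S ((hout S).1 hS)).2.2.2
    refine ⟨(Event.work 1 :: if Odd d then outputSet P else []) ++
      substLog g (childrenLog O P) ++ if Even d then outputSet P else [],
      (outputs (childrenLog O P)).toFinset.sup N + 1, ?_, ?_, ?_, ?_⟩
    · intro n hn
      obtain ⟨m, rfl⟩ : ∃ m, n = m + 1 := ⟨n - 1, by omega⟩
      refine spawn_succ m d P fun S hS => (hg S ((hout S).1 hS)).1 m ?_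
      have := Finset.le_sup (f := N) (List.mem_toFinset.2 hS)
      omega
    · intro S
      rw [isAncestor_iff, ← hbody_mem]
      by_cases hd : Even d
      · have hd' : ¬ Odd d := Nat.not_odd_iff_even.2 hd
        simp [hd, hd', outputs_append, outputSet, or_comm]
      · have hd' : Odd d := Nat.not_even_iff_odd.1 hd
        simp [hd, hd', outputSet]
    · by_cases hd : Even d
      · have hd' : ¬ Odd d := Nat.not_odd_iff_even.2 hd
        simp only [hd, hd', if_true, if_false, outputs_append, outputSet, outputs_work,
          outputs_emit, outputs_nil, List.nil_append]
        rw [List.nodup_append_comm]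
        exact List.nodup_cons.2 ⟨hP_notMem, hbody_nodup⟩
      · have hd' : Odd d := Nat.not_even_iff_odd.1 hd
        simp only [hd, hd', if_true, if_false, outputs_append, outputSet, outputs_work,
          outputs_emit, outputs_nil, List.append_nil]
        exact List.nodup_cons.2 ⟨hP_notMem, hbody_nodup⟩
    · intro acc rest h₁ h₂
      by_cases hd : Even d
      · have hd' : ¬ Odd d := Nat.not_odd_iff_even.2 hd
        have hd₁ : ¬ Even (d + 1) := by rwa [Nat.even_add_one, not_not]
        simp only [hd, hd₁, hd', if_true, if_false, outputSet, List.append_assoc, List.cons_append,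
          List.nil_append, delayFrom] at h₁ h₂ hbound ⊢
        -- The children are at odd depth: the gap before the output of `P` consists of at most `W`
        -- steps left by a child, own work `W`, and the writing, or it begins with the incoming `acc
        -- + 1` steps.
        refine delayFrom_substLog_le (hW P hP) hbound (by omega) (by omega) ?_
        simp only [delayFrom]
        exact max_le (by omega) h₂
      · have hd' : Odd d := Nat.not_even_iff_odd.1 hd
        have hd₁ : Even (d + 1) := hd'.add_one
        simp only [hd, hd₁, hd', if_true, if_false, outputSet, List.append_assoc, List.cons_append,
          List.nil_append, delayFrom] at h₁ h₂ hbound ⊢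
        refine max_le (by omega) ?_
        -- The output of `P` has reset the count; own work `W` and the start-up `2 + W + |U|` of a
        -- child at even depth give exactly the lower bound assumed for `D`.
        refine delayFrom_substLog_le (hW P hP) hbound (by omega) (by omega) ?_
        simpa using h₂

theorem run_spec (hF : IsCommutable F) {W V : ℕ}
    (hW : ∀ P, IsMaximalSol F P → totalWork (childrenLog O P) ≤ W)
    (hV : totalWork (roots O) ≤ V) :
    ∃ l : Log U, Terminates O l ∧ (outputs l).Nodup ∧
      (∀ S, S ∈ outputs l ↔ IsMaximalSol F S) ∧ delay l ≤ 2 * W + V + 2 + Fintype.card U := by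
  set D := 2 * W + V + 2 + Fintype.card U with hD
  have hex : ∀ S, ∃ (L : Log U) (N : ℕ), IsMaximalSol F S →
      (∀ n ≥ N, spawn O n 0 S = some L) ∧
      (∀ X, X ∈ outputs L ↔ IsAncestor O X S) ∧ (outputs L).Nodup ∧
      DelayBound (2 + W + Fintype.card U) 0 D L := by
    intro S
    by_cases hS : IsMaximalSol F S
    · obtain ⟨L, N, h⟩ := spawn_spec (D := D) hF hW (by omega) hS 0
      exact ⟨L, N, fun _ => by simpa using h⟩
    · exact ⟨[], 0, fun h => absurd h hS⟩
  choose g N hg using hex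
  have hout : ∀ S, S ∈ outputs (roots O) ↔ IsMaximalSol F S ∧ (corePi O S).val = none :=
    fun S => mem_outputs_roots hF
  refine ⟨substLog g (roots O), ⟨(outputs (roots O)).toFinset.sup N, fun n hn => ?_⟩, ?_, ?_, ?_⟩
  · refine expand_eq_some fun S hS => (hg S ((hout S).1 hS).1).1 n ?_
    exact (Finset.le_sup (f := N) (List.mem_toFinset.2 hS)).trans hn
  · rw [outputs_substLog]
    refine nodup_flatMap_of_unique nodup_outputs_roots
      (fun S hS => (hg S ((hout S).1 hS).1).2.2.1) ?_
    intro S hS S' hS' X hX hX'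
    rw [hout] at hS hS'
    exact IsAncestor.eq_of_root hS.2 hS'.2 (((hg S hS.1).2.1 X).1 hX)
      (((hg S' hS'.1).2.1 X).1 hX')
  · intro S
    rw [outputs_substLog, List.mem_flatMap]
    constructor
    · rintro ⟨R, hR, hS⟩
      rw [hout] at hR
      exact (((hg R hR.1).2.1 S).1 hS).isMaximalSol hR.1
    · intro hS
      obtain ⟨R, hR, hR', hSR⟩ := exists_root (O := O) hF hS
      exact ⟨R, (hout R).2 ⟨hR, hR'⟩, ((hg R hR).2.1 S).2 hSR⟩
  · have := delayFrom_substLog_le (g := g) (h := 2 + W + Fintype.card U) (t := 0) (D := D)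
      (l := roots O) (W := V) (acc := 0) (rest := []) hV
      (fun S hS => (hg S ((hout S).1 hS).1).2.2.2) (by omega) (by omega)
      (by simp only [delayFrom]; omega)
    simpa [delay] using this

end Termination

/-! ### Running times of loops -/

section GenericCost

variable {U α σ : Type u}

theorem forEach_time_le {body : σ → α → Timed σ} {f : α → ℕ} {l : List α}
    (h : ∀ s, ∀ a ∈ l, (body s a).time ≤ f a) (s : σ) :
    (forEach body l s).time ≤ 1 + (l.map fun a => 1 + f a).sum := by
  induction l generalizing s with
  | nil => simp [forEach]
  | cons a l ih =>
    have h₁ := h s a (by simp)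
    have h₂ := ih (fun s b hb => h s b (by simp [hb])) (body s a).val
    simp only [forEach, Timed.time_after, Timed.time_bind, List.map_cons, List.sum_cons]
    omega

theorem findFirst_time_le {p : α → Timed (ULift Bool)} {f : α → ℕ} {l : List α}
    (h : ∀ a ∈ l, (p a).time ≤ f a) :
    (findFirst p l).time ≤ 1 + (l.map fun a => 1 + f a).sum := by
  induction l with
  | nil => simp [findFirst]
  | cons a l ih =>
    have h₁ := h a (by simp)
    have h₂ := ih fun b hb => h b (by simp [hb])
    simp only [findFirst, Timed.time_after, Timed.time_bind, List.map_cons, List.sum_cons]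
    split_ifs
    · simp only [Timed.time_pure]; omega
    · omega

theorem totalWork_forLog_le {l : List α} {body : α → Log U} {f : α → ℕ}
    (h : ∀ a ∈ l, totalWork (body a) ≤ f a) :
    totalWork (forLog l body) ≤ (l.map fun a => 1 + f a).sum := by
  induction l with
  | nil => simp [forLog, totalWork]
  | cons a l ih =>
    have h₁ := h a (by simp)
    have h₂ := ih fun b hb => h b (by simp [hb])
    have : forLog (a :: l) body = Event.work 1 :: body a ++ forLog l body := by simp [forLog]
    rw [this, totalWork_append]
    simp only [totalWork, List.map_cons, List.sum_cons]
    omega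

theorem totalWork_andThen (x : Timed α) (k : α → Log U) :
    totalWork (x.andThen k) = x.time + totalWork (k x.val) := rfl

end GenericCost

/-! ### Running times of the routines -/

section Cost

variable {U : Type u} [Fintype U] [LinearOrder U] {F : Finset (Finset U)} {O : BlackBox F}
  {q G : ℕ}

/-- A loop over `U` that is expensive only on members of `X` costs `X.card` times the expensive
part; this is how factors q arise in place of `|U|`. -/
theorem sum_elems_le {f : U → ℕ} (X : Finset U) (a b : ℕ)
    (h : ∀ x, f x ≤ a + if x ∈ X then b else 0) :
    ((elems U).map f).sum ≤ Fintype.card U * a + X.card * b := by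
  have h₁ : ((elems U).map f).sum = ∑ x, f x := by
    rw [← List.sum_toFinset f elems_nodup]
    congr 1
    ext x
    simp
  rw [h₁]
  calc ∑ x, f x ≤ ∑ x, (a + if x ∈ X then b else 0) := Finset.sum_le_sum fun x _ => h x
    _ = Fintype.card U * a + X.card * b := by
      rw [Finset.sum_add_distrib]
      simp

theorem sum_elems_le_const {f : U → ℕ} (a : ℕ) (h : ∀ x, f x ≤ a) :
    ((elems U).map f).sum ≤ Fintype.card U * a := by
  simpa using sum_elems_le ∅ a 0 (by simpa using h)

/-- The quantities `q` and `G` in which running times are estimated. -/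
structure CostParams (O : BlackBox F) (q G : ℕ) : Prop where
  one_le_size : 1 ≤ q
  size_le_card : q ≤ Fintype.card U
  card_le : ∀ X ∈ F, X.card ≤ q
  one_le_test : 1 ≤ G
  test_le : ∀ X, O.testTime X ≤ G

/-- All lower-order terms are absorbed into the unit `q * |U| * G`, the order of the cost of one
call of `choose`. -/
theorem CostParams.unit_bounds (h : CostParams O q G) :
    1 ≤ q * Fintype.card U * G ∧ Fintype.card U ≤ q * Fintype.card U * G ∧
      G ≤ q * Fintype.card U * G ∧ q ≤ q * Fintype.card U * G ∧
      q * Fintype.card U ≤ q * Fintype.card U * G ∧ q * G ≤ q * Fintype.card U * G ∧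
      q * q ≤ q * Fintype.card U * G ∧ q * q * G ≤ q * Fintype.card U * G := by
  have h₁ := h.one_le_size
  have h₂ := h.size_le_card
  have h₃ := h.one_le_test
  set n := Fintype.card U
  have hqn : 1 ≤ q * n := Nat.mul_pos h₁ (by omega)
  have hn : n ≤ q * n := Nat.le_mul_of_pos_left _ h₁
  have hq : q ≤ q * n := Nat.le_mul_of_pos_right _ (by omega)
  have hM : q * n ≤ q * n * G := Nat.le_mul_of_pos_right _ h₃
  have hqq : q * q ≤ q * n := Nat.mul_le_mul le_rfl h₂
  refine ⟨by omega, by omega, Nat.le_mul_of_pos_left _ hqn, by omega, hM,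
    Nat.mul_le_mul hq le_rfl, by omega, Nat.mul_le_mul hqq le_rfl⟩

theorem canAdd_time_le (h : CostParams O q G) (X : Finset U) (y : U) :
    (canAdd O X y).time ≤ G + 3 := by
  have := h.test_le (insert y X)
  simp only [canAdd, Timed.time_bind, contains]
  split_ifs
  · simp
  · simp only [Timed.time_after, test]
    omega

theorem isGood_time_le (h : CostParams O q G) (x : U) :
    (isGood O x).time ≤ Fintype.card U + 1 + G := by
  have := h.test_le (insert x ∅)
  simp only [isGood, Timed.time_bind, emptySet, insertElt, test]
  omega

theorem source_time_le (h : CostParams O q G) {X : Finset U} (hX : X ∈ F) :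
    (source O X).time ≤ 6 * (q * Fintype.card U * G) := by
  have h₁ := findFirst_time_le (l := elems U) (p := fun x => do
      let b ← contains x X
      if b.down then isGood O x else pure ⟨false⟩)
    (f := fun x => 1 + if x ∈ X then Fintype.card U + 1 + G else 0) (by
      intro x _
      have := isGood_time_le h x
      by_cases hx : x ∈ X
      · simp [contains, hx, this]
      · simp [contains, hx])
  have h₂ := sum_elems_le (f := fun x => 1 + (1 + if x ∈ X then Fintype.card U + 1 + G else 0)) X 2
    (Fintype.card U + 1 + G) (fun x => by omega)
  have h₃ := Nat.mul_le_mul_right (Fintype.card U + 1 + G) (h.card_le X hX)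
  obtain ⟨b₁, b₂, b₃, b₄, b₅, b₆, b₇, b₈⟩ := h.unit_bounds
  refine h₁.trans ?_
  linarith

theorem nextLayer_time_le (h : CostParams O q G) {X : Finset U} (hX : X ∈ F) (B : Finset U) :
    (nextLayer O X B).time ≤ 1 + 3 * Fintype.card U + q * (G + 4) := by
  have h₁ := forEach_time_le (l := elems U) (body := fun C y => do
      let b ← contains y X
      if b.down then
        let c ← canAdd O B y
        if c.down then insertElt y C else pure C
      else pure C)
    (f := fun x => 1 + if x ∈ X then G + 4 else 0) (by
      intro C y _
      have := canAdd_time_le h B y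
      by_cases hy : y ∈ X
      · simp only [contains, hy, decide_true, Timed.time_bind, if_true]
        split_ifs <;> simp [insertElt] <;> omega
      · simp [contains, hy]) B
  have h₂ := sum_elems_le (f := fun x => 1 + (1 + if x ∈ X then G + 4 else 0)) X 2
    (G + 4) (fun x => by omega)
  have h₃ := Nat.mul_le_mul_right (G + 4) (h.card_le X hX)
  have h₄ : (nextLayer O X B).time ≤ Fintype.card U +
    (1 + ((elems U).map fun x => 1 + (1 + if x ∈ X then G + 4 else 0)).sum) :=
      Nat.add_le_add_left h₁ _
  linarith

theorem layerSets_time_le (h : CostParams O q G) {X : Finset U} (hX : X ∈ F) (k : ℕ) :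
    ∀ B, (layerSets O X k B).time ≤ k + 1 + k * (1 + 3 * Fintype.card U + q * (G + 4)) := by
  induction k with
  | zero => intro B; simp [layerSets]
  | succ k ih =>
    intro B
    have h₁ := nextLayer_time_le h hX B
    have h₂ := ih (nextLayer O X B).val
    simp only [layerSets, Timed.time_after, Timed.time_bind, Timed.time_pure]
    rw [Nat.succ_mul]
    omega

theorem length_layerSets (X : Finset U) (k : ℕ) :
    ∀ B, (layerSets O X k B).val.length = k + 1 := by
  induction k with
  | zero => intro B; rfl
  | succ k ih =>
    intro B
    simp only [layerSets, Timed.val_after, Timed.val_bind, Timed.val_pure, List.length_cons, ih]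

theorem layerOf_time_le (h : CostParams O q G) (y : U) (l : List (Finset U)) :
    (layerOf O y l).time ≤ 1 + l.length * (G + 4) := by
  induction l with
  | nil => simp [layerOf]
  | cons B l ih =>
    have := canAdd_time_le h B y
    simp only [layerOf, Timed.time_after, Timed.time_bind, List.length_cons, Nat.succ_mul]
    split_ifs
    · simp only [Timed.time_pure]; omega
    · simp only [Timed.time_bind, Timed.time_pure]; omega

theorem chooseStep_time_le (h : CostParams O q G) (X A : Finset U) (Bs : List (Finset U))
    (best : Option (ULift.{u} (WithTop ℕ) × U)) (y : U) :
    (chooseStep O X A Bs best y).time ≤ G + 6 + Bs.length * (G + 4) := by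
  have h₁ := canAdd_time_le h X y
  have h₂ := layerOf_time_le h y Bs
  simp only [chooseStep, Timed.time_bind, contains]
  split_ifs
  · simp only [Timed.time_bind]
    split_ifs
    · simp only [Timed.time_bind, Timed.time_after]
      rcases best with _ | ⟨l', y'⟩
      · simp only [Timed.time_pure]; omega
      · dsimp only
        split_ifs <;> simp only [Timed.time_pure] <;> omega
    · simp only [Timed.time_pure]; omega
  · simp only [Timed.time_pure]; omega

/-- At most q further layers are computed, each testing at most q elements; then every label of `U`
is compared with at most q + 1 layer sets. Both parts are within the unit, as q ≤ `|U|`. -/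
theorem choose_time_le (h : CostParams O q G) {X : Finset U} (hX : X ∈ F) (A : Finset U) :
    (choose O X A).time ≤ 40 * (q * Fintype.card U * G) := by
  have h₁ := source_time_le h hX
  have hXq := h.card_le X hX
  obtain ⟨b₁, b₂, b₃, b₄, b₅, b₆, b₇, b₈⟩ := h.unit_bounds
  cases hs : (source O X).val with
  | none =>
    simp only [choose, Timed.time_bind, hs, Timed.time_pure]
    omega
  | some t =>
    have h₂ := layerSets_time_le h hX X.card {t}
    have h₃ : X.card * (1 + 3 * Fintype.card U + q * (G + 4)) ≤
      q * (1 + 3 * Fintype.card U + q * (G + 4)) := Nat.mul_le_mul_right _ hXq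
    have h₄ := forEach_time_le (l := elems U)
      (body := chooseStep O X A (layerSets O X X.card {t}).val)
      (f := fun _ => G + 6 + (X.card + 1) * (G + 4))
      (fun best y _ => by
        have := chooseStep_time_le h X A (layerSets O X X.card {t}).val best y
        rwa [length_layerSets] at this) none
    have h₅ := sum_elems_le_const (U := U) (f := fun _ => 1 + (G + 6 + (X.card + 1) * (G + 4))) _
      (fun _ => le_rfl)
    -- With q for `X.card` the left side is `qG + 4q + 2G + 11`, whose coefficients add up to 18.
    have h₆ : 1 + (G + 6 + (X.card + 1) * (G + 4)) ≤ 18 * (q * G) := by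
      have hqG : 1 ≤ q * G := Nat.mul_pos h.one_le_size h.one_le_test
      have hG : G ≤ q * G := Nat.le_mul_of_pos_left _ h.one_le_size
      have hq : q ≤ q * G := Nat.le_mul_of_pos_right _ h.one_le_test
      have := Nat.mul_le_mul_right (G + 4) (Nat.succ_le_succ hXq)
      simp only [Nat.succ_eq_add_one] at this
      linarith
    have h₇ := Nat.mul_le_mul_left (Fintype.card U) h₆
    have h₈ : (choose O X A).time = (source O X).time + (Fintype.card U + (Fintype.card U + (1 +
        ((layerSets O X X.card {t}).time +
          (forEach (chooseStep O X A (layerSets O X X.card {t}).val) (elems U) none).time)))) := by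
      simp only [choose, Timed.time_bind, hs, Timed.time_pure, insert_empty_eq, sizeOfSet,
        emptySet, insertElt]
      rfl
    rw [h₈]
    linarith

/-- A bound for the loops that add an element to a solution in each iteration. -/
theorem loop_bound_le {q M : ℕ} (hq : 1 ≤ q) (k : ℕ) : (q + 1 - k) * M ≤ 2 * (q * M) := by
  calc (q + 1 - k) * M ≤ (2 * q) * M := Nat.mul_le_mul_right _ (by omega)
    _ = 2 * (q * M) := by ring

theorem loop_bound_succ {q M : ℕ} {k : ℕ} (hk : k + 1 ≤ q) :
    M + (q + 1 - (k + 1)) * M ≤ (q + 1 - k) * M := by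
  have : q + 1 - k = (q + 1 - (k + 1)) + 1 := by omega
  rw [this, Nat.succ_mul, add_comm]

theorem le_loop_bound {q M : ℕ} {k : ℕ} (hk : k ≤ q) : M ≤ (q + 1 - k) * M :=
  Nat.le_mul_of_pos_left _ (by omega)

/-- Intermediate sets are solutions, so the factor `q + 1 - X.card` covers the possible additions
and one last failing call. Each iteration pays 40 units for `choose`, and three steps besides. -/
theorem completeLoop_time_le (hF : IsCommutable F) (h : CostParams O q G) (A : Finset U)
    (halt : Option U) : ∀ n X, X ∈ F →
      (completeLoop O A halt n X).time ≤
        (q + 1 - X.card) * (43 * (q * Fintype.card U * G)) := by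
  obtain ⟨b₁, b₂, b₃, b₄, b₅, b₆, b₇, b₈⟩ := h.unit_bounds
  intro n
  induction n with
  | zero => intro X _; simp [completeLoop]
  | succ n ih =>
    intro X hX
    have h₁ := choose_time_le h hX A
    have h₂ := le_loop_bound (M := 43 * (q * Fintype.card U * G)) (h.card_le X hX)
    simp only [completeLoop, Timed.time_after, Timed.time_bind]
    cases hc : (choose O X A).val with
    | none => simp only [Timed.time_pure]; omega
    | some x =>
      simp only [Timed.time_after]
      split_ifs
      · simp only [Timed.time_pure]; omega
      · have hx := mem_plus.1 (mem_plus_of_choose hF hX hc)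
        have h₃ := h.card_le _ hx.2.2
        have h₄ := ih (insert x X) hx.2.2
        rw [Finset.card_insert_of_notMem hx.2.1] at h₃ h₄
        have h₅ := loop_bound_succ (M := 43 * (q * Fintype.card U * G)) h₃
        simp only [Timed.time_bind, insertElt]
        omega

theorem CostParams.le_mul (h : CostParams O q G) (M : ℕ) : M ≤ q * M :=
  Nat.le_mul_of_pos_left _ h.one_le_size

theorem complete_time_le (hF : IsCommutable F) (h : CostParams O q G) {X : Finset U} (hX : X ∈ F)
    (A : Finset U) : (complete O X A).time ≤ 87 * (q * (q * Fintype.card U * G)) := by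
  obtain ⟨b₁, b₂, b₃, b₄, b₅, b₆, b₇, b₈⟩ := h.unit_bounds
  have h₁ := completeLoop_time_le hF h A none (Fintype.card U + 1) X hX
  have h₂ := loop_bound_le (M := 43 * (q * Fintype.card U * G)) h.one_le_size X.card
  have h₃ := h.le_mul (q * Fintype.card U * G)
  simp only [complete, Timed.time_bind, copySet]
  linarith

theorem completeUntil_time_le (hF : IsCommutable F) (h : CostParams O q G) {X : Finset U}
    (hX : X ∈ F) (w : U) (A : Finset U) :
    (completeUntil O w X A).time ≤ 87 * (q * (q * Fintype.card U * G)) := by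
  obtain ⟨b₁, b₂, b₃, b₄, b₅, b₆, b₇, b₈⟩ := h.unit_bounds
  have h₁ := completeLoop_time_le hF h A (some w) (Fintype.card U + 1) X hX
  have h₂ := loop_bound_le (M := 43 * (q * Fintype.card U * G)) h.one_le_size X.card
  have h₃ := h.le_mul (q * Fintype.card U * G)
  simp only [completeUntil, Timed.time_bind, copySet]
  linarith

theorem corePiLoop_time_le (hF : IsCommutable F) (h : CostParams O q G) (S V : Finset U) :
    ∀ n X r, X ∈ F → (corePiLoop O S V n X r).time ≤
      (q + 1 - X.card) * (84 * (q * Fintype.card U * G)) := by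
  obtain ⟨b₁, b₂, b₃, b₄, b₅, b₆, b₇, b₈⟩ := h.unit_bounds
  intro n
  induction n with
  | zero => intro X r _; simp [corePiLoop]
  | succ n ih =>
    intro X r hX
    have h₁ := choose_time_le h hX S
    have h₁' := choose_time_le h hX V
    have h₂ := le_loop_bound (M := 84 * (q * Fintype.card U * G)) (h.card_le X hX)
    simp only [corePiLoop, Timed.time_after, Timed.time_bind]
    cases hc : (choose O X S).val with
    | none => simp only [Timed.time_pure]; omega
    | some x =>
      have hx := mem_plus.1 (mem_plus_of_choose hF hX hc)
      have h₃ := h.card_le _ hx.2.2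
      have h₄ := fun r => ih (insert x X) r hx.2.2
      rw [Finset.card_insert_of_notMem hx.2.1] at h₃ h₄
      have h₅ := loop_bound_succ (M := 84 * (q * Fintype.card U * G)) h₃
      simp only [Timed.time_bind, Timed.time_after, Timed.val_after, insertElt]
      split_ifs
      · have := h₄ r
        simp only [Timed.time_pure, Timed.val_pure]
        omega
      · have := h₄ (some (X, x))
        simp only [Timed.time_pure, Timed.time_bind, Timed.val_bind, Timed.val_pure, copySet]
        omega

theorem corePi_time_le (hF : IsCommutable F) (h : CostParams O q G) {S : Finset U} (hS : S ∈ F) :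
    (corePi O S).time ≤ 177 * (q * (q * Fintype.card U * G)) := by
  obtain ⟨b₁, b₂, b₃, b₄, b₅, b₆, b₇, b₈⟩ := h.unit_bounds
  have h₁ := source_time_le h hS
  have h₃ := h.le_mul (q * Fintype.card U * G)
  cases hs : (source O S).val with
  | none =>
    simp only [corePi, Timed.time_bind, hs, Timed.time_pure]
    omega
  | some t =>
    have h₄ := corePiLoop_time_le hF h S Finset.univ (Fintype.card U + 1) {t} none
      (source_val_eq_some.1 hs).1.2
    have h₅ := loop_bound_le (M := 84 * (q * Fintype.card U * G)) h.one_le_size ({t} : Finset U).card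
    simp only [corePi, Timed.time_bind, hs, fullSet, emptySet, insertElt, insert_empty_eq]
    linarith

/-- The four completions and `corePi` give `4 * 87 + 177 = 525`; the rest covers the source and the
operations on arrays. -/
theorem candidate_time_le (hF : IsCommutable F) (h : CostParams O q G) (P : Finset U)
    {R : Finset U} {w s : U} (hR : R ∈ F) (hw : w ∈ R) (hs : s ∈ R) (hsF : {s} ∈ F) :
    (candidate O P w R s).time ≤ 560 * (q * (q * Fintype.card U * G)) := by
  obtain ⟨b₁, b₂, b₃, b₄, b₅, b₆, b₇, b₈⟩ := h.unit_bounds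
  have hM := h.le_mul (q * Fintype.card U * G)
  have hK := insert_completeUntil_mem (O := O) hF (w := w) hsF (Finset.singleton_nonempty s)
    (by simpa using hs) hR hw
  have hS := candidate_isMaximalSol (O := O) hF hR hw hs hsF
  have h₁ := completeUntil_time_le hF h hsF w R
  have h₂ := complete_time_le hF h hK Finset.univ
  have h₃ := corePi_time_le hF h hS.mem
  have h₄ := source_time_le h hS.mem
  simp only [candidate, Timed.time_bind, fullSet_val, emptySet_val, insertElt_val,
    insert_empty_eq]
  cases hcp : (corePi O (complete O (insert w (completeUntil O w {s} R).val)
      Finset.univ).val).val with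
  | none =>
    simp only [Timed.time_pure, fullSet, emptySet, insertElt]
    linarith
  | some cp =>
    obtain ⟨C, v⟩ := cp
    obtain ⟨t, ht⟩ := hF.1.exists_isSource hS.mem (IsMaximalSol.nonempty_of_corePi hcp)
    have hcore := (corePi_val_eq_some hF hS.mem ht).1 hcp
    have h₅ := complete_time_le hF h (hcore.mem hF hS.mem ht) Finset.univ
    have h₆ := complete_time_le hF h (hcore.insert_mem hF hS.mem ht)
      (insert v (complete O C Finset.univ).val)
    simp only [Timed.time_bind, Timed.time_after, fullSet, emptySet, insertElt, copySet, sameSet,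
      sameElt]
    split_ifs <;> simp only [Timed.time_pure] <;> linarith

theorem isStart_time_le (h : CostParams O q G) (R : Finset U) (w s : U) :
    (isStart O R w s).time ≤ 1 + if s ∈ R then Fintype.card U + 2 + G else 0 := by
  have := isGood_time_le h s
  by_cases hs : s ∈ R
  · simp only [isStart, Timed.time_bind, contains, hs, decide_true, if_true, sameElt]
    split_ifs
    · simp only [Timed.time_pure]; omega
    · omega
  · simp [isStart, contains, hs]

theorem totalWork_match (r : Option (Finset U)) :
    totalWork (match r with | none => [] | some S => [Event.emit S] : Log U) = 0 := by
  cases r <;> rfl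

/-- For each listed `R`, only its at most q members can lead to a call of `candidate`, which
accounts for the third factor q. -/
theorem totalWork_children_le (hF : IsCommutable F) (h : CostParams O q G) {P : Finset U}
    (hP : IsMaximalSol F P) {R_T R_B : ℕ} (w : U)
    (hT : ∀ w ∉ P, O.restrTime P w ≤ R_T) (hB : ∀ w ∉ P, (O.restr P w).length ≤ R_B) :
    totalWork (children O P w) ≤
      1 + R_T + R_B * (570 * (q * (q * (q * Fintype.card U * G)))) := by
  obtain ⟨b₁, b₂, b₃, b₄, b₅, b₆, b₇, b₈⟩ := h.unit_bounds
  have hM := h.le_mul (q * Fintype.card U * G)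
  have hM' := h.le_mul (q * (q * Fintype.card U * G))
  rw [children, totalWork_andThen]
  by_cases hw : w ∈ P
  · simp only [contains, hw, decide_true, if_true, totalWork]
    omega
  simp only [contains_val, hw, decide_false, Bool.false_eq_true, if_false, totalWork_andThen,
    solveRestr_val]
  have key : ∀ R ∈ O.restr P w, totalWork (sameSet R P |>.andThen fun isP =>
        if isP.down then []
        else forLog (elems U) fun s => (isStart O R w s).andThen fun ok =>
          if ok.down then (candidate O P w R s).andThen fun res =>
            match res with
            | none => []
            | some S => [Event.emit S]
          else [] : Log U) ≤ 569 * (q * (q * (q * Fintype.card U * G))) := by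
    intro R hR
    rw [totalWork_andThen]
    by_cases hRP : R = P
    · simp only [sameSet, hRP, decide_true, if_true, totalWork]
      omega
    rw [O.mem_restr P hP w hw R hRP] at hR
    have hwR := mem_of_isMaximalIn_insert hP hR hRP
    simp only [sameSet_val, hRP, decide_false, Bool.false_eq_true, if_false]
    have h₁ := totalWork_forLog_le (l := elems U) (body := fun s =>
        (isStart O R w s).andThen fun ok =>
          if ok.down then (candidate O P w R s).andThen fun res =>
            match res with
            | none => []
            | some S => [Event.emit S]
          else [])
      (f := fun s => 1 + if s ∈ R then
        Fintype.card U + 2 + G + 560 * (q * (q * Fintype.card U * G)) else 0) (by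
        intro s _
        have h₂ := isStart_time_le h R w s
        rw [totalWork_andThen, isStart_val]
        by_cases hs : s ∈ R ∧ s ≠ w ∧ {s} ∈ F
        · have h₃ := candidate_time_le hF h P hR.1 hwR hs.1 hs.2.2
          rw [if_pos (decide_eq_true hs), totalWork_andThen, totalWork_match]
          simp only [hs.1, if_true] at h₂ ⊢
          omega
        · simp only [hs, decide_false, Bool.false_eq_true, if_false, totalWork]
          split_ifs at h₂ ⊢ <;> omega)
    have h₄ := sum_elems_le (f := fun s => 1 + (1 + if s ∈ R then
        Fintype.card U + 2 + G + 560 * (q * (q * Fintype.card U * G)) else 0)) R 2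
        (Fintype.card U + 2 + G + 560 * (q * (q * Fintype.card U * G))) (fun x => by omega)
    have h₅ := Nat.mul_le_mul (h.card_le R hR.1) (show
        Fintype.card U + 2 + G + 560 * (q * (q * Fintype.card U * G)) ≤
          564 * (q * (q * Fintype.card U * G)) by omega)
    have h₆ : (sameSet R P).time = Fintype.card U := rfl
    linarith
  have h₁ := totalWork_forLog_le key
  have h₂ : (((O.restr P w).map fun _ =>
      1 + 569 * (q * (q * (q * Fintype.card U * G)))).sum) ≤
        R_B * (570 * (q * (q * (q * Fintype.card U * G)))) := by
    rw [List.map_const', List.sum_replicate, smul_eq_mul]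
    exact Nat.mul_le_mul (hB w hw) (by omega)
  have hT' : (solveRestr O P w).time ≤ R_T := hT w hw
  refine (Nat.add_le_add_left (Nat.add_le_add hT' (h₁.trans h₂)) 1).trans ?_
  omega

theorem totalWork_childrenLog_le (hF : IsCommutable F) (h : CostParams O q G) {P : Finset U}
    (hP : IsMaximalSol F P) {R_T R_B : ℕ}
    (hT : ∀ w ∉ P, O.restrTime P w ≤ R_T) (hB : ∀ w ∉ P, (O.restr P w).length ≤ R_B) :
    totalWork (childrenLog O P) ≤ Fintype.card U *
      (2 + R_T + R_B * (570 * (q * (q * (q * Fintype.card U * G))))) := by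
  refine (totalWork_forLog_le fun w _ => totalWork_children_le hF h hP w hT hB).trans ?_
  refine sum_elems_le_const _ fun _ => ?_
  omega

theorem totalWork_roots_le (hF : IsCommutable F) (h : CostParams O q G) :
    totalWork (roots O) ≤
      Fintype.card U * (110 * (q * (q * (q * Fintype.card U * G)))) := by
  obtain ⟨b₁, b₂, b₃, b₄, b₅, b₆, b₇, b₈⟩ := h.unit_bounds
  have hM := h.le_mul (q * Fintype.card U * G)
  have hM' := h.le_mul (q * (q * Fintype.card U * G))
  set K := q * (q * (q * Fintype.card U * G)) with hK
  have hn : 1 ≤ Fintype.card U := h.one_le_size.trans h.size_le_card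
  have hnK : K ≤ Fintype.card U * K := Nat.le_mul_of_pos_left _ hn
  have h₁ := findFirst_time_le (l := elems U) (p := isGood O) (f := fun _ => 3 * K)
    (fun x _ => (isGood_time_le h x).trans (by omega))
  have h₂ := sum_elems_le_const (U := U) (f := fun _ => 1 + 3 * K) (4 * K) (fun _ => by omega)
  rw [roots_eq, totalWork_andThen]
  cases (findFirst (isGood O) (elems U)).val with
  | none =>
    simp only [totalWork]
    linarith
  | some z =>
    have h₃ := totalWork_forLog_le (l := elems U) (body := fun s =>
        (isGood O s).andThen fun ok =>
          if ok.down then (rootCandidate O s).andThen fun r =>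
            Event.work 1 :: if r.2 = some s then [Event.emit r.1] else []
          else []) (f := fun _ => 100 * K) (by
        intro s _
        have h₄ := isGood_time_le h s
        rw [totalWork_andThen, isGood_val]
        by_cases hs : {s} ∈ F
        · have h₅ := complete_time_le hF h hs Finset.univ
          have h₆ := source_time_le h (complete_mem (O := O) (A := Finset.univ) hF hs
            (Finset.singleton_nonempty s))
          have h₇ : totalWork (if (rootCandidate O s).val.2 = some s then
            [Event.emit (rootCandidate O s).val.1] else [] : Log U) = 0 := by split_ifs <;> rfl
          simp only [hs, decide_true, if_true, totalWork_andThen, totalWork, h₇]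
          simp only [rootCandidate, Timed.time_bind, Timed.time_pure, fullSet, emptySet, insertElt,
            insert_empty_eq]
          omega
        · simp only [hs, decide_false, Bool.false_eq_true, if_false, totalWork]
          omega)
    have h₈ := sum_elems_le_const (U := U) (f := fun _ => 1 + 100 * K) (101 * K)
      (fun _ => by omega)
    dsimp only
    linarith

theorem card_le_maxSize {X : Finset U} (hX : X ∈ F) : X.card ≤ maxSize F :=
  Finset.le_sup (f := Finset.card) hX

theorem maxSize_le_card (F : Finset (Finset U)) : maxSize F ≤ Fintype.card U :=
  Finset.sup_le fun X _ => Finset.card_le_univ X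

/-- Writing `K` for `q ^ 3 * n * G`, the left side is at most `2 * n * R_T` plus `(1140 + 110 + 7) *
n * R_B * K`. -/
theorem delay_bound_arith {n q G R_T R_B W V : ℕ} (hn : 1 ≤ n) (hq : 1 ≤ q) (hG : 1 ≤ G)
    (hB : 1 ≤ R_B) (hW : W ≤ n * (2 + R_T + R_B * (570 * (q * (q * (q * n * G))))))
    (hV : V ≤ n * (110 * (q * (q * (q * n * G))))) :
    2 * W + V + 2 + n ≤ 1300 * (R_T * n + q ^ 3 * n ^ 2 * G * R_B) := by
  set K := q * (q * (q * n * G)) with hK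
  have hK1 : 1 ≤ K := by
    have : 0 < K := by positivity
    omega
  have h₁ : q ^ 3 * n ^ 2 * G * R_B = n * (R_B * K) := by rw [hK]; ring
  have h₂ : K ≤ R_B * K := Nat.le_mul_of_pos_left _ hB
  have h₃ := Nat.mul_le_mul_left n h₂
  have h₄ : n ≤ n * K := Nat.le_mul_of_pos_right _ hK1
  rw [h₁]
  nlinarith

end Cost

/-! ### Connected hereditary systems -/

section Hereditary

variable {U : Type u} [Fintype U] [LinearOrder U] {F : Finset (Finset U)} {G : SimpleGraph U}

/-- A walk inside `Y` from `X` to a point outside leaves `X` along some edge. The outer endpoint of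
this edge can be added, as `X` together with the edge is connected. -/
theorem IsConnectedHereditary.isStronglyAccessible (h : IsConnectedHereditary G F) :
    IsStronglyAccessible F := by
  obtain ⟨h₀, hconn, hher⟩ := h
  refine ⟨h₀, fun X hX Y hY hXY => ?_⟩
  obtain ⟨y, hyY, hyX⟩ := Finset.exists_of_ssubset hXY
  rcases X.eq_empty_or_nonempty with rfl | ⟨x, hx⟩
  · refine ⟨y, by simpa using hyY, hher _ Y hY (by simpa using hyY) (by simp) ?_⟩
    rw [insert_empty_eq, Finset.coe_singleton]
    exact ⟨SimpleGraph.Preconnected.of_subsingleton⟩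
  · have hYc := hconn Y hY ⟨y, hyY⟩
    obtain ⟨p⟩ := hYc.preconnected ⟨x, hXY.1 hx⟩ ⟨y, hyY⟩
    obtain ⟨d, -, hd₁, hd₂⟩ := p.exists_boundary_dart {z | (z : U) ∈ X} hx hyX
    have hadj : G.Adj (d.fst : U) (d.snd : U) := d.adj
    refine ⟨d.snd, Finset.mem_sdiff.2 ⟨d.snd.2, hd₂⟩, hher _ Y hY
      (Finset.insert_subset d.snd.2 hXY.1) (Finset.insert_nonempty _ _) ?_⟩
    have hu := SimpleGraph.induce_union_connected (hconn X hX ⟨x, hx⟩).preconnected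
      (SimpleGraph.induce_pair_connected_of_adj hadj).preconnected
      ⟨(d.fst : U), hd₁, by simp⟩
    have hEq : ((insert (d.snd : U) X : Finset U) : Set U) = ↑X ∪ {(d.fst : U), (d.snd : U)} := by
      ext z
      simp only [Finset.coe_insert, Set.mem_insert_iff, Finset.mem_coe, Set.mem_union,
        Set.mem_singleton_iff]
      constructor
      · tauto
      · rintro (hz | rfl | hz)
        · exact Or.inr hz
        · exact Or.inr hd₁
        · exact Or.inl hz
    rwa [hEq]

/-- Two connected sets sharing a point of `X` have a connected union; this is where `X` must be
nonempty. -/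
theorem IsConnectedHereditary.isCommutable (h : IsConnectedHereditary G F) :
    IsCommutable F := by
  refine ⟨h.isStronglyAccessible, ?_⟩
  obtain ⟨h₀, hconn, hher⟩ := h
  intro X hX Y hY ⟨x, hx⟩ hXY a ha b hb haF hbF
  rw [Finset.mem_sdiff] at ha hb
  have hu := SimpleGraph.induce_union_connected
    (hconn _ haF (Finset.insert_nonempty _ _)).preconnected
    (hconn _ hbF (Finset.insert_nonempty _ _)).preconnected ⟨x, by simp [hx], by simp [hx]⟩
  refine hher _ Y hY ?_ (Finset.insert_nonempty _ _) ?_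
  · exact Finset.insert_subset ha.1 (Finset.insert_subset hb.1 hXY.1)
  · have hEq : ((insert a (insert b X) : Finset U) : Set U) =
        ((insert a X : Finset U) : Set U) ∪ ((insert b X : Finset U) : Set U) := by
      ext z
      simp
      tauto
    rwa [hEq]

end Hereditary

end MaxEnum

open MaxEnum in
theorem mainTheorem4 :
    (∃ c : ℕ, ∀ (U : Type u) [Fintype U] [LinearOrder U] (F : Finset (Finset U))
      (O : BlackBox F) (G_T R_T R_B : ℕ),
      IsCommutable F →
      1 ≤ G_T → (∀ X : Finset U, O.testTime X ≤ G_T) →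
      (∀ P, IsMaximalSol F P → ∀ w ∉ P, O.restrTime P w ≤ R_T) →
      1 ≤ R_B → (∀ P, IsMaximalSol F P → ∀ w ∉ P, (O.restr P w).length ≤ R_B) →
      ChooseIsCorrect O ∧ CorePiIsCorrect O ∧
      ∃ l : Log U, Terminates O l ∧
        (outputs l).Nodup ∧ (∀ S, S ∈ outputs l ↔ IsMaximalSol F S) ∧
        (1 ≤ maxSize F →
          delay l ≤ c * (R_T * Fintype.card U +
            maxSize F ^ 3 * Fintype.card U ^ 2 * G_T * R_B))) ∧
    (∀ (U : Type u) [Fintype U] [LinearOrder U] (G : SimpleGraph U) (F : Finset (Finset U)),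
      IsConnectedHereditary G F → IsCommutable F) := by
  refine ⟨⟨1300, ?_⟩, fun U _ _ G F h => h.isCommutable⟩
  intro U _ _ F O G_T R_T R_B hF hG htest hRT hRB hlen
  refine ⟨chooseIsCorrect hF, corePiIsCorrect hF, ?_⟩
  by_cases hq : 1 ≤ maxSize F
  · have hp : CostParams O (maxSize F) G_T :=
      ⟨hq, maxSize_le_card F, fun _ => card_le_maxSize, hG, htest⟩
    obtain ⟨l, h₁, h₂, h₃, h₄⟩ := run_spec hF
      (fun P hP => totalWork_childrenLog_le hF hp hP (hRT P hP) (hlen P hP))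
      (totalWork_roots_le hF hp)
    exact ⟨l, h₁, h₂, h₃, fun _ => h₄.trans
      (delay_bound_arith (hq.trans (maxSize_le_card F)) hq hG hRB le_rfl le_rfl)⟩
  -- For q = 0 no delay is claimed, but `run_spec` still needs some bound on the work per call; the
  -- supremum over the finitely many sets serves.
  · obtain ⟨l, h₁, h₂, h₃, -⟩ := run_spec (O := O) hF
      (W := (Finset.univ : Finset (Finset U)).sup fun P => totalWork (childrenLog O P))
      (fun P _ => Finset.le_sup (f := fun P => totalWork (childrenLog O P)) (Finset.mem_univ P))
      le_rfl
    exact ⟨l, h₁, h₂, h₃, fun h => absurd h hq⟩
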